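/- Let $k\ge 1$ and let $\Lambda$ be a $k$-graph, i.e. a countable category with range and source maps $r,s$ and a degree functor $d:\Lambda\to\mathbb N^k$ such that whenever $d(\lambda)=m+n$ there are unique $\mu,\nu\in\Lambda$ with $\lambda=\mu\nu$, $d(\mu)=m$, $d(\nu)=n$. Let $\Lambda^0\neq\emptyset$ be its set of objects (vertices), and for $v,w\in\Lambda^0$, $n\in\mathbb N^k$ write $v\Lambda w=\{\lambda: r(\lambda)=v,\ s(\lambda)=w\}$, $\Lambda^n=\{\lambda: d(\lambda)=n\}$ and $v\Lambda^n=\{\lambda\in\Lambda^n: r(\lambda)=v\}$. Assume that $\Lambda$ is row-finite with no sources, i.e. every $v\Lambda^n$ is finite and nonempty. Let $R$ be a commutative ring with $1\neq 0$. The Kumjian–Pask algebra $\mathrm{KP}_R(\Lambda)$ is the universal (not necessarily unital) $R$-algebra generated by elements $p_v$ ($v\in\Lambda^0$) and $s_\lambda,s_{\lambda^*}$ ($\lambda\in\Lambda$), where $s_v=s_{v^*}=p_v$ for $v\in\Lambda^0$, subject to the relations 1. the $p_v$ are mutually orthogonal idempotents; 2. $s_\lambda s_\mu=s_{\lambda\mu}$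 and $s_{\mu^*}s_{\lambda^*}=s_{(\lambda\mu)^*}$ whenever $s(\lambda)=r(\mu)$, and $p_{r(\lambda)}s_\lambda=s_\lambda=s_\lambda p_{s(\lambda)}$, $p_{s(\lambda)}s_{\lambda^*}=s_{\lambda^*}=s_{\lambda^*}p_{r(\lambda)}$; 3. $s_{\lambda^*}s_\mu=\delta_{\lambda,\mu}\,p_{s(\lambda)}$ for all $n\in\mathbb N^k\setminus\{0\}$ and $\lambda,\mu\in\Lambda^n$; 4. $p_v=\sum_{\lambda\in v\Lambda^n}s_\lambda s_{\lambda^*}$ for all $v\in\Lambda^0$ and $n\in\mathbb N^k\setminus\{0\}$. It is $\mathbb Z^k$-graded with components $\mathrm{KP}_R(\Lambda)_n=\mathrm{span}_R\{s_\alpha s_{\beta^*}: d(\alpha)-d(\beta)=n\}$. A two-sided ideal $I$ of $\mathrm{KP}_R(\Lambda)$ is *graded* if each of its elements is a finite sum of elements of the sets $I\cap\mathrm{KP}_R(\Lambda)_n$, and *basic* if $r p_v\in I$ with $v\in\Lambda^0$ and $0\ne r\in R$ implies $p_v\in I$. Put $H_I=\{v\in\Lambda^0: p_v\in I\}$. A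 ring is *prime* if for any two-sided ideals $I_1,I_2$ with $I_1I_2=0$ one has $I_1=0$ or $I_2=0$. Then the following are equivalent: (1) $\mathrm{KP}_R(\Lambda)$ is a prime ring; (2) $R$ is an integral domain and $\Lambda^0$ satisfies Condition (MT3): for all $v_1,v_2\in\Lambda^0$ there is $w\in\Lambda^0$ with $v_1\Lambda w\neq\emptyset$ and $v_2\Lambda w\neq\emptyset$; (3) $R$ is an integral domain and $H_I\cap H_J\neq\emptyset$ for all nonzero basic graded ideals $I,J$ of $\mathrm{KP}_R(\Lambda)$. -/

import Mathlib

open CategoryTheory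

universe u v w

noncomputable section

/-- A `k`-graph with vertex set `V`: a countable category with object set `V` and a degree functor
to `ℕ^k` having the factorization property. A morphism `f : a ⟶ b` is a path with source `a` and
range `b`; the product of paths `αβ` (defined if `s(α) = r(β)`) is the composite `α ∘ β`, which is
`β ≫ α` in Mathlib's order. -/
structure KGraph (k : ℕ) (V : Type u) [Category.{v} V] extends CountableCategory V where
  /-- the degree map -/
  d : ∀ {a b : V}, (a ⟶ b) → (Fin k → ℕ)
  d_id : ∀ a : V, d (𝟙 a) = 0
  d_comp : ∀ {a b c : V} (α : b ⟶ c) (β : a ⟶ b), d (β ≫ α) = d α + d β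
  /-- the factorization property: if `d(f) = m + n`, then there are unique paths `μ, ν` with
  `f = μν`, `d(μ) = m` and `d(ν) = n` -/
  factorization : ∀ {a b : V} (f : a ⟶ b) (m n : Fin k → ℕ), d f = m + n →
    ∃! p : (c : V) × ((c ⟶ b) × (a ⟶ c)),
      p.2.2 ≫ p.2.1 = f ∧ d p.2.1 = m ∧ d p.2.2 = n

/-- Generators of the Kumjian-Pask algebra: vertices, paths and ghost paths. An element
`x : Quiver.Total V` is a path with source `x.left` and range `x.right`. -/
inductive KPGen (V : Type u) [Quiver.{v} V] : Type (max u v)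
  | vertex (a : V) : KPGen V
  | path (x : Quiver.Total V) : KPGen V
  | ghost (x : Quiver.Total V) : KPGen V

namespace KGraph

variable {k : ℕ} {V : Type u} [Category.{v} V] (Λ : KGraph k V)

/-- `vΛ^n` is finite for all vertices `v` and all `n`. -/
def RowFinite : Prop :=
  ∀ (a : V) (n : Fin k → ℕ), {x : Quiver.Total V | x.right = a ∧ Λ.d x.hom = n}.Finite

/-- `vΛ^n` is nonempty for all vertices `v` and all `n`. -/
def NoSources : Prop :=
  ∀ (a : V) (n : Fin k → ℕ), ∃ (b : V) (f : b ⟶ a), Λ.d f = n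

/-- The set `Λ^{≤ n}` of the paths `x` with `d(x) ≤ n` such that `s(x)Λ^{e_i}` is empty
whenever `d(x) + e_i ≤ n`. -/
def pathsLE (n : Fin k → ℕ) : Set (Quiver.Total V) :=
  {x | Λ.d x.hom ≤ n ∧ ∀ i : Fin k, Λ.d x.hom + Pi.single i 1 ≤ n →
    ¬ ∃ (b : V) (g : b ⟶ x.left), Λ.d g = Pi.single i 1}

/-- Condition (MT3) for a set `M` of vertices. -/
def MT3 (M : Set V) : Prop :=
  ∀ a ∈ M, ∀ b ∈ M, ∃ c ∈ M, Nonempty (c ⟶ a) ∧ Nonempty (c ⟶ b)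

variable (R : Type w) [CommRing R]

/-- `P_v`, as an element of the free algebra. -/
def freeP (a : V) : FreeAlgebra R (KPGen V) := FreeAlgebra.ι R (KPGen.vertex a)

/-- `S_f`, as an element of the free algebra. -/
def freeS {a b : V} (f : a ⟶ b) : FreeAlgebra R (KPGen V) :=
  FreeAlgebra.ι R (KPGen.path ⟨a, b, f⟩)

/-- `S_{f*}`, as an element of the free algebra. -/
def freeSs {a b : V} (f : a ⟶ b) : FreeAlgebra R (KPGen V) :=
  FreeAlgebra.ι R (KPGen.ghost ⟨a, b, f⟩)

/-- The Kumjian-Pask relations. The first two identify the path and the ghost path of degree `0`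
at the vertex `a` with the vertex `a`. In `kp4` the finite set `F` is `vΛ^{≤ n}`. -/
inductive KPRel : FreeAlgebra R (KPGen V) → FreeAlgebra R (KPGen V) → Prop
  | path_id (a : V) : KPRel (freeS R (𝟙 a)) (freeP R a)
  | ghost_id (a : V) : KPRel (freeSs R (𝟙 a)) (freeP R a)
  | kp1_idem (a : V) : KPRel (freeP R a * freeP R a) (freeP R a)
  | kp1_orth (a b : V) (h : a ≠ b) : KPRel (freeP R a * freeP R b) 0
  | kp2_path {a b c : V} (f : b ⟶ c) (g : a ⟶ b) :
      KPRel (freeS R f * freeS R g) (freeS R (g ≫ f))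
  | kp2_ghost {a b c : V} (f : b ⟶ c) (g : a ⟶ b) :
      KPRel (freeSs R g * freeSs R f) (freeSs R (g ≫ f))
  | kp2_range_path {a b : V} (f : a ⟶ b) : KPRel (freeP R b * freeS R f) (freeS R f)
  | kp2_path_source {a b : V} (f : a ⟶ b) : KPRel (freeS R f * freeP R a) (freeS R f)
  | kp2_source_ghost {a b : V} (f : a ⟶ b) : KPRel (freeP R a * freeSs R f) (freeSs R f)
  | kp2_ghost_range {a b : V} (f : a ⟶ b) : KPRel (freeSs R f * freeP R b) (freeSs R f)
  | kp3_same (n : Fin k → ℕ) (hn : n ≠ 0) (x : Quiver.Total V) (hx : x ∈ Λ.pathsLE n) :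
      KPRel (freeSs R x.hom * freeS R x.hom) (freeP R x.left)
  | kp3_ne (n : Fin k → ℕ) (hn : n ≠ 0) (x y : Quiver.Total V) (hx : x ∈ Λ.pathsLE n)
      (hy : y ∈ Λ.pathsLE n) (hxy : x ≠ y) :
      KPRel (freeSs R x.hom * freeS R y.hom) 0
  | kp4 (a : V) (n : Fin k → ℕ) (hn : n ≠ 0) (F : Finset (Quiver.Total V))
      (hF : ∀ x, x ∈ F ↔ x.right = a ∧ x ∈ Λ.pathsLE n) :
      KPRel (freeP R a) (∑ x ∈ F, freeS R x.hom * freeSs R x.hom)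

/-- The universal unital `R`-algebra generated by a Kumjian-Pask `Λ`-family. -/
abbrev UnitalKP : Type (max u v w) := RingQuot (Λ.KPRel R)

/-- The Kumjian-Pask algebra `KP_R(Λ)`, a not necessarily unital `R`-algebra: the subalgebra
(without the unit) generated by the universal family. It is the universal `R`-algebra, among all
not necessarily unital ones, generated by a Kumjian-Pask `Λ`-family: `UnitalKP` is obtained from
it by adjoining a unit. -/
abbrev KP : Type (max u v w) :=
  ↥(NonUnitalAlgebra.adjoin R
    (Set.range fun g : KPGen V => RingQuot.mkAlgHom R (Λ.KPRel R) (FreeAlgebra.ι R g)))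

/-- The generators, as elements of the Kumjian-Pask algebra. -/
def gen (g : KPGen V) : Λ.KP R :=
  ⟨RingQuot.mkAlgHom R (Λ.KPRel R) (FreeAlgebra.ι R g),
    NonUnitalAlgebra.subset_adjoin R ⟨g, rfl⟩⟩

/-- The vertex idempotent `p_v`. -/
def p (a : V) : Λ.KP R := Λ.gen R (KPGen.vertex a)

/-- The element `s_x` of a path `x`. -/
def s (x : Quiver.Total V) : Λ.KP R := Λ.gen R (KPGen.path x)

/-- The element `s_{x*}` of the ghost path of a path `x`. -/
def sStar (x : Quiver.Total V) : Λ.KP R := Λ.gen R (KPGen.ghost x)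

/-- The homogeneous component of degree `n ∈ ℤ^k`: the span of the `s_x s_{y*}` with
`d(x) - d(y) = n`. -/
def component (n : Fin k → ℤ) : Submodule R (Λ.KP R) :=
  Submodule.span R {z | ∃ x y : Quiver.Total V,
    (∀ i, (Λ.d x.hom i : ℤ) - (Λ.d y.hom i : ℤ) = n i) ∧ z = Λ.s R x * Λ.sStar R y}

variable {R}

/-- An ideal is graded if each of its elements is a finite sum of homogeneous elements of the
ideal. -/
def IsGradedIdeal (I : TwoSidedIdeal (Λ.KP R)) : Prop :=
  ∀ x ∈ I, x ∈ AddSubgroup.closure {y : Λ.KP R | y ∈ I ∧ ∃ n, y ∈ Λ.component R n}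

/-- An ideal is basic if `r p_v ∈ I` with `r ≠ 0` implies `p_v ∈ I`. -/
def IsBasicIdeal (I : TwoSidedIdeal (Λ.KP R)) : Prop :=
  ∀ (r : R) (a : V), r ≠ 0 → r • Λ.p R a ∈ I → Λ.p R a ∈ I

/-- The set `H_I` of the vertices `v` with `p_v ∈ I`. -/
def vertexSet (I : TwoSidedIdeal (Λ.KP R)) : Set V := {a | Λ.p R a ∈ I}

end KGraph

/-- A two-sided ideal `I` is prime if `I₁ I₂ ⊆ I` implies `I₁ ⊆ I` or `I₂ ⊆ I` for all two-sided
ideals `I₁, I₂`. -/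
def IsPrimeTwoSided {A : Type u} [NonUnitalRing A] (I : TwoSidedIdeal A) : Prop :=
  ∀ I₁ I₂ : TwoSidedIdeal A, (∀ x ∈ I₁, ∀ y ∈ I₂, x * y ∈ I) → I₁ ≤ I ∨ I₂ ≤ I

/-- A ring is prime if its zero ideal is prime. -/
def IsPrimeRing (A : Type u) [NonUnitalRing A] : Prop :=
  IsPrimeTwoSided (⊥ : TwoSidedIdeal A)

end

/-! Everything rests on two facts about the algebra. The first is a compression: a nonzero
homogeneous element is a finite combination of `s_x s_{y*}`, and expanding with relation 4 brings
all the `y` to one common degree. Then multiplying by `s_{x*}` on the left and `s_y` on the right,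
for one pair that occurs, kills every other term and leaves `r p_v` with `v = s(x)` and `r ≠ 0`
(`exists_sStar_mul_mul_s_eq_smul`). The second is that `r p_v ≠ 0` whenever `r ≠ 0`
(`smul_p_ne_zero`). It is seen by letting the algebra act on functions on infinite paths, which
exist at every vertex by König's lemma. The grading is encoded by a coaction into the group algebra
of `ℤ^k`, whose coefficients at `z` are the homogeneous parts of `z`.

From primeness to (2): if `rt = 0`, then `r p_v` and `t p_v` annihilate each other across the whole
algebra. If no vertex reaches both `a` and `b`, then `p_a z p_b = 0` for all `z`, because such
products are spanned by the `s_x s_{y*}` with `r(x) = a`, `r(y) = b`, `s(x) = s(y)`.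

From (2) to primeness: given nonzero elements of two ideals, choose degrees in their supports whose
sum arises in only one way (`ℤ^k` has unique sums). Compress these two homogeneous parts to
multiples of vertex idempotents, and use (MT3) to prolong the compressing paths to one common vertex
`c`. The degree-zero part of the product of the two compressed elements is `r t p_c`, nonzero over a
domain.

From (2) to (3): compression puts a vertex into each nonzero basic graded ideal, the vertices of an
ideal form a hereditary set, and (MT3) joins the two sets. From (3) to (2): for the hereditary set
`H` of the vertices reachable from `a`, take the kernel of the graded representation on the infinite
paths avoiding `H`. By König's lemma a vertex `c` lies in this ideal only if all paths of some
degree with range `c` have their source in `H`. A vertex common to the ideals of `a` and `b`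
therefore leads to one reachable from both. -/

noncomputable section

namespace KGraph

variable {k : ℕ} {V : Type u} [Category.{v} V] (Λ : KGraph k V)

/-! ### Paths and their segments -/

/-- The degree of a path. -/
def deg (x : Quiver.Total V) : Fin k → ℕ := Λ.d x.hom

/-- The path of degree `0` at a vertex. -/
abbrev idPath (a : V) : Quiver.Total V := ⟨a, a, 𝟙 a⟩

/-- The product `xy` of two paths with `s(x) = r(y)`. -/
abbrev comp (x y : Quiver.Total V) (h : x.left = y.right) : Quiver.Total V :=
  ⟨y.left, x.right, y.hom ≫ eqToHom h.symm ≫ x.hom⟩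

@[simp] lemma comp_left (x y : Quiver.Total V) (h : x.left = y.right) :
    (comp x y h).left = y.left := rfl

@[simp] lemma comp_right (x y : Quiver.Total V) (h : x.left = y.right) :
    (comp x y h).right = x.right := rfl

lemma comp_mk {a b c : V} (f : b ⟶ c) (g : a ⟶ b) :
    comp ⟨b, c, f⟩ ⟨a, b, g⟩ rfl = ⟨a, c, g ≫ f⟩ := by
  simp [comp]

@[simp] lemma deg_idPath (a : V) : Λ.deg (idPath a) = 0 := Λ.d_id a

@[simp] lemma deg_comp (x y : Quiver.Total V) (h : x.left = y.right) :
    Λ.deg (comp x y h) = Λ.deg x + Λ.deg y := by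
  obtain ⟨b, c, f⟩ := x
  obtain ⟨a, b', g⟩ := y
  obtain rfl : b = b' := h
  rw [comp_mk]
  exact Λ.d_comp f g

@[simp] lemma comp_idPath (x : Quiver.Total V) (a : V) (h : x.left = (idPath a).right) :
    comp x (idPath a) h = x := by
  obtain ⟨b, c, f⟩ := x
  obtain rfl : b = a := h
  rw [comp_mk, Category.id_comp]

@[simp] lemma idPath_comp (x : Quiver.Total V) (a : V) (h : (idPath a).left = x.right) :
    comp (idPath a) x h = x := by
  obtain ⟨b, c, f⟩ := x
  obtain rfl : a = c := h
  rw [comp_mk, Category.comp_id]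

lemma comp_assoc (x y z : Quiver.Total V) (h : x.left = y.right) (h' : y.left = z.right) :
    comp (comp x y h) z h' = comp x (comp y z h') h := by
  obtain ⟨c, e, f⟩ := x
  obtain ⟨b, c', g⟩ := y
  obtain ⟨a, b', l⟩ := z
  obtain rfl : c = c' := h
  obtain rfl : b = b' := h'
  simp only [comp_mk, Category.assoc]

/-- Uniqueness of factorizations. Comparing the degrees of the first factors suffices, as those of
the second follow by cancellation in `ℕ^k`. -/
lemma comp_injective {x y x' y' : Quiver.Total V} {h : x.left = y.right}
    {h' : x'.left = y'.right} (e : comp x y h = comp x' y' h') (hd : Λ.deg x = Λ.deg x') :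
    x = x' ∧ y = y' := by
  have hd' : Λ.deg y = Λ.deg y' := by
    have := congrArg Λ.deg e
    rw [deg_comp, deg_comp, hd] at this
    exact add_left_cancel this
  obtain ⟨b, c, f⟩ := x
  obtain ⟨a, b₁, g⟩ := y
  obtain ⟨b', c', f'⟩ := x'
  obtain ⟨a', b₁', g'⟩ := y'
  obtain rfl : b = b₁ := h
  obtain rfl : b' = b₁' := h'
  rw [comp_mk, comp_mk] at e
  obtain rfl : a = a' := congrArg Quiver.Total.left e
  obtain rfl : c = c' := congrArg Quiver.Total.right e
  have e' : g ≫ f = g' ≫ f' := by simpa using e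
  obtain ⟨q, -, hq⟩ := Λ.factorization (g ≫ f) (Λ.d f) (Λ.d g) (Λ.d_comp f g)
  have h₁ := hq ⟨b, f, g⟩ ⟨rfl, rfl, rfl⟩
  have h₂ := hq ⟨b', f', g'⟩ ⟨e'.symm, hd.symm, hd'.symm⟩
  obtain h₃ := h₁.trans h₂.symm
  cases h₃
  exact ⟨rfl, rfl⟩

lemma exists_comp_eq (z : Quiver.Total V) (m n : Fin k → ℕ) (h : Λ.deg z = m + n) :
    ∃ (x y : Quiver.Total V) (e : x.left = y.right),
      comp x y e = z ∧ Λ.deg x = m ∧ Λ.deg y = n := by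
  obtain ⟨a, b, f⟩ := z
  obtain ⟨⟨c, g, l⟩, ⟨h₁, h₂, h₃⟩, -⟩ := Λ.factorization f m n h
  exact ⟨⟨c, b, g⟩, ⟨a, c, l⟩, rfl, by rw [comp_mk]; simp only at h₁; rw [h₁], h₂, h₃⟩

/-- Both `x · id` and `id · x` factor `x` with degrees `0 + 0`, so uniqueness identifies the
factors. -/
lemma eq_idPath_right {x : Quiver.Total V} (h : Λ.deg x = 0) : x = idPath x.right :=
  (Λ.comp_injective (x := x) (y := idPath x.left) (x' := idPath x.right) (y' := x)
    (h := rfl) (h' := rfl) (by simp) (by simp [h])).1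

lemma left_eq_right {x : Quiver.Total V} (h : Λ.deg x = 0) : x.left = x.right := by
  conv_lhs => rw [Λ.eq_idPath_right h]

/-- The initial segment of degree `n` of a path of degree at least `n`. -/
def pre (n : Fin k → ℕ) (z : Quiver.Total V) : Quiver.Total V :=
  open Classical in
  if h : n ≤ Λ.deg z then
    (Λ.exists_comp_eq z n (Λ.deg z - n) (add_tsub_cancel_of_le h).symm).choose else z

/-- What is left of a path of degree at least `n` after its initial segment of degree `n`. -/
def suf (n : Fin k → ℕ) (z : Quiver.Total V) : Quiver.Total V :=
  open Classical in
  if h : n ≤ Λ.deg z then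
    (Λ.exists_comp_eq z n (Λ.deg z - n) (add_tsub_cancel_of_le h).symm).choose_spec.choose else z

variable {Λ} in
lemma pre_suf {n : Fin k → ℕ} {z : Quiver.Total V} (h : n ≤ Λ.deg z) :
    ∃ e : (Λ.pre n z).left = (Λ.suf n z).right,
      comp (Λ.pre n z) (Λ.suf n z) e = z ∧ Λ.deg (Λ.pre n z) = n ∧
        Λ.deg (Λ.suf n z) = Λ.deg z - n := by
  simp only [pre, suf, dif_pos h]
  exact (Λ.exists_comp_eq z n (Λ.deg z - n)
    (add_tsub_cancel_of_le h).symm).choose_spec.choose_spec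

variable {Λ} in
lemma deg_pre {n : Fin k → ℕ} {z : Quiver.Total V} (h : n ≤ Λ.deg z) : Λ.deg (Λ.pre n z) = n :=
  (pre_suf h).choose_spec.2.1

variable {Λ} in
lemma deg_suf {n : Fin k → ℕ} {z : Quiver.Total V} (h : n ≤ Λ.deg z) :
    Λ.deg (Λ.suf n z) = Λ.deg z - n :=
  (pre_suf h).choose_spec.2.2

variable {Λ} in
lemma pre_right {n : Fin k → ℕ} {z : Quiver.Total V} (h : n ≤ Λ.deg z) :
    (Λ.pre n z).right = z.right :=
  (comp_right _ _ _).symm.trans (congrArg Quiver.Total.right (pre_suf h).choose_spec.1)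

variable {Λ} in
lemma suf_left {n : Fin k → ℕ} {z : Quiver.Total V} (h : n ≤ Λ.deg z) :
    (Λ.suf n z).left = z.left :=
  (comp_left _ _ _).symm.trans (congrArg Quiver.Total.left (pre_suf h).choose_spec.1)

variable {Λ} in
lemma suf_right {n : Fin k → ℕ} {z : Quiver.Total V} (h : n ≤ Λ.deg z) :
    (Λ.suf n z).right = (Λ.pre n z).left :=
  (pre_suf h).choose.symm

lemma comp_eq_iff {x y z : Quiver.Total V} (h : x.left = y.right) :
    comp x y h = z ↔ Λ.deg x ≤ Λ.deg z ∧ Λ.pre (Λ.deg x) z = x ∧ Λ.suf (Λ.deg x) z = y := by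
  constructor
  · rintro rfl
    have hle : Λ.deg x ≤ Λ.deg (comp x y h) := by simp
    obtain ⟨e, h₁, h₂, -⟩ := pre_suf hle
    exact ⟨hle, Λ.comp_injective h₁ h₂⟩
  · rintro ⟨hle, h₁, h₂⟩
    obtain ⟨e, h₃, -⟩ := pre_suf hle
    subst h₂
    simp only [h₁] at h₃
    exact h₃

lemma pre_comp {x y : Quiver.Total V} (h : x.left = y.right) {n : Fin k → ℕ} (hn : Λ.deg x = n) :
    Λ.pre n (comp x y h) = x := by
  subst hn
  exact ((Λ.comp_eq_iff h).1 rfl).2.1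

lemma suf_comp {x y : Quiver.Total V} (h : x.left = y.right) {n : Fin k → ℕ} (hn : Λ.deg x = n) :
    Λ.suf n (comp x y h) = y := by
  subst hn
  exact ((Λ.comp_eq_iff h).1 rfl).2.2

lemma pre_self {x : Quiver.Total V} {n : Fin k → ℕ} (hn : Λ.deg x = n) : Λ.pre n x = x := by
  simpa using Λ.pre_comp (x := x) (y := idPath x.left) rfl hn

variable {Λ} in
lemma pre_pre_of_le {m n : Fin k → ℕ} {z : Quiver.Total V} (hmn : m ≤ n) (hn : n ≤ Λ.deg z) :
    Λ.pre m (Λ.pre n z) = Λ.pre m z := by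
  obtain ⟨e, h₁, h₂, -⟩ := pre_suf hn
  obtain ⟨e', h₁', h₂', -⟩ := pre_suf (h₂.symm ▸ hmn : m ≤ Λ.deg (Λ.pre n z))
  generalize Λ.pre n z = p at *
  generalize Λ.suf n z = s at *
  generalize Λ.pre m p = p' at *
  generalize Λ.suf m p = s' at *
  subst h₁'
  subst h₁
  rw [comp_assoc _ _ _ e' e, pre_comp _ _ h₂']

variable {Λ} in
lemma suf_suf {m n : Fin k → ℕ} {z : Quiver.Total V} (h : m + n ≤ Λ.deg z) :
    Λ.suf n (Λ.suf m z) = Λ.suf (m + n) z := by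
  have hm : m ≤ Λ.deg z := le_self_add.trans h
  obtain ⟨e, h₁, h₂, h₃⟩ := pre_suf hm
  obtain ⟨e', h₁', h₂', -⟩ :=
    pre_suf (h₃.symm ▸ le_tsub_of_add_le_left h : n ≤ Λ.deg (Λ.suf m z))
  generalize Λ.pre m z = p at *
  generalize Λ.suf m z = s at *
  generalize Λ.pre n s = p' at *
  generalize Λ.suf n s = s' at *
  subst h₁'
  subst h₁
  rw [← comp_assoc _ _ _ (e.trans (comp_right _ _ _)) e', suf_comp]
  simp [h₂, h₂']

variable {Λ} in
lemma suf_pre_add {m n : Fin k → ℕ} {z : Quiver.Total V} (h : m + n ≤ Λ.deg z) :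
    Λ.suf m (Λ.pre (m + n) z) = Λ.pre n (Λ.suf m z) := by
  have hm : m ≤ Λ.deg z := le_self_add.trans h
  obtain ⟨e, h₁, h₂, h₃⟩ := pre_suf hm
  obtain ⟨e', h₁', h₂', -⟩ :=
    pre_suf (h₃.symm ▸ le_tsub_of_add_le_left h : n ≤ Λ.deg (Λ.suf m z))
  generalize Λ.pre m z = p at *
  generalize Λ.suf m z = s at *
  generalize Λ.pre n s = p' at *
  generalize Λ.suf n s = s' at *
  subst h₁'
  subst h₁
  rw [← comp_assoc _ _ _ (e.trans (comp_right _ _ _)) e', pre_comp _ _ (by simp [h₂, h₂']),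
    suf_comp _ _ h₂]

/-! ### Infinite paths -/

/-- An infinite path: a path of each degree, each an initial segment of the later ones. -/
structure InfPath where
  /-- the initial segment of degree `n` -/
  seg : (Fin k → ℕ) → Quiver.Total V
  deg_seg : ∀ n, Λ.deg (seg n) = n
  pre_seg : ∀ {m n}, m ≤ n → Λ.pre m (seg n) = seg m

namespace InfPath

variable {Λ}

attribute [simp] deg_seg

lemma ext {x y : Λ.InfPath} (h : ∀ n, x.seg n = y.seg n) : x = y := by
  cases x; cases y
  congr
  exact funext h

/-- The range of an infinite path. -/
def range (x : Λ.InfPath) : V := (x.seg 0).right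

lemma seg_right (x : Λ.InfPath) (n : Fin k → ℕ) : (x.seg n).right = x.range := by
  rw [range, ← x.pre_seg (zero_le : 0 ≤ n), pre_right (by simp)]

/-- The infinite path `λx`. -/
def cons (l : Quiver.Total V) (x : Λ.InfPath) (h : l.left = x.range) : Λ.InfPath where
  -- The path `l x(n)` is longer than needed and is cut back to degree `n`; this avoids `n - d(l)`,
  -- which may not exist in `ℕ^k`.
  seg n := Λ.pre n (comp l (x.seg n) (h.trans (x.seg_right n).symm))
  deg_seg n := deg_pre (by simp)
  pre_seg {m n} hmn := by
    rw [pre_pre_of_le hmn (by simp)]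
    have hr : (x.seg m).left = (Λ.suf m (x.seg n)).right := by
      rw [suf_right (by simpa using hmn), x.pre_seg hmn]
    have hx : x.seg n = comp (x.seg m) (Λ.suf m (x.seg n)) hr :=
      ((Λ.comp_eq_iff hr).2 (by simp [x.pre_seg hmn, hmn])).symm
    have : comp l (x.seg n) (h.trans (x.seg_right n).symm) =
        comp (comp l (x.seg m) (h.trans (x.seg_right m).symm)) (Λ.suf m (x.seg n)) hr := by
      rw [comp_assoc]
      simp only [← hx]
    have hp := Λ.pre_comp (x := comp l (x.seg m) (h.trans (x.seg_right m).symm)) hr rfl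
    rw [this, ← pre_pre_of_le (n := Λ.deg (comp l (x.seg m) (h.trans (x.seg_right m).symm)))
      (by simp) (by simp), hp]

/-- The infinite path left after removing the initial segment of degree `p`. -/
def shift (p : Fin k → ℕ) (x : Λ.InfPath) : Λ.InfPath where
  seg n := Λ.suf p (x.seg (p + n))
  deg_seg n := by rw [deg_suf (by simp)]; simp
  pre_seg {m n} hmn := by
    rw [← suf_pre_add (by simpa using hmn), x.pre_seg (by simpa using hmn)]

lemma range_cons (l : Quiver.Total V) (x : Λ.InfPath) (h : l.left = x.range) :
    (cons l x h).range = l.right := by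
  rw [range, cons]
  exact pre_right (by simp)

lemma range_shift (p : Fin k → ℕ) (x : Λ.InfPath) : (shift p x).range = (x.seg p).left := by
  rw [range, shift]
  simp only
  rw [suf_right (by simp), x.pre_seg (by simp)]

lemma seg_cons (l : Quiver.Total V) (x : Λ.InfPath) (h : l.left = x.range) :
    (cons l x h).seg (Λ.deg l) = l :=
  Λ.pre_comp _ rfl

lemma shift_cons (l : Quiver.Total V) (x : Λ.InfPath) (h : l.left = x.range) :
    shift (Λ.deg l) (cons l x h) = x := by
  refine InfPath.ext fun n => ?_
  simp only [shift, cons]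
  rw [suf_pre_add (by simp), suf_comp _ _ rfl, x.pre_seg (by simp)]

/-- With `shift_cons`, this makes shifting and prefixing mutually inverse between the paths `x` that
begin with `l` and those with range `s(l)`. The operators of `l` and of its ghost are built on this.
-/
lemma cons_shift (p : Fin k → ℕ) (x : Λ.InfPath) :
    cons (x.seg p) (shift p x) (range_shift p x).symm = x := by
  refine InfPath.ext fun n => ?_
  simp only [cons, shift]
  rw [(Λ.comp_eq_iff (z := x.seg (p + n)) _).2 (by simp [x.pre_seg]), x.pre_seg (by simp)]

lemma shift_shift (p q : Fin k → ℕ) (x : Λ.InfPath) : shift q (shift p x) = shift (p + q) x := by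
  refine InfPath.ext fun n => ?_
  simp only [shift]
  rw [suf_suf (by simp), add_assoc]

/-- By `cons_shift` an infinite path is determined by its segment of degree `d(l)` and its shift by
`d(l)`, so only these are compared, and then once more with `m`. -/
lemma cons_cons (l m : Quiver.Total V) (x : Λ.InfPath) (h : l.left = m.right)
    (h' : m.left = x.range) :
    cons l (cons m x h') (h.trans (range_cons m x h').symm) = cons (comp l m h) x h' := by
  have h₁ : (cons (comp l m h) x h').seg (Λ.deg l) = l := by
    rw [← (cons (comp l m h) x h').pre_seg (n := Λ.deg (comp l m h)) (by simp), seg_cons,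
      pre_comp _ _ rfl]
  have h₂ : shift (Λ.deg l) (cons (comp l m h) x h') = cons m x h' := by
    have h₃ : (shift (Λ.deg l) (cons (comp l m h) x h')).seg (Λ.deg m) = m := by
      simp only [shift]
      rw [← deg_comp _ _ _ h, seg_cons, suf_comp _ _ rfl]
    have h₄ : shift (Λ.deg m) (shift (Λ.deg l) (cons (comp l m h) x h')) = x := by
      rw [shift_shift, ← deg_comp _ _ _ h, shift_cons]
    have := cons_shift (Λ.deg m) (shift (Λ.deg l) (cons (comp l m h) x h'))
    simp only [h₃, h₄] at this
    exact this.symm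
  have := cons_shift (Λ.deg l) (cons (comp l m h) x h')
  simp only [h₁, h₂] at this
  exact this

lemma seg_add (x : Λ.InfPath) (p q : Fin k → ℕ) :
    ∃ h, x.seg (p + q) = comp (x.seg p) ((shift p x).seg q) h := by
  refine ⟨((shift p x).seg_right q |>.trans (range_shift p x)).symm, ?_⟩
  exact ((Λ.comp_eq_iff _).2 (by simp [x.pre_seg, shift])).symm

lemma seg_deg_comp_iff (x : Λ.InfPath) (l m : Quiver.Total V) (h : l.left = m.right) :
    x.seg (Λ.deg (comp l m h)) = comp l m h ↔
      x.seg (Λ.deg l) = l ∧ (shift (Λ.deg l) x).seg (Λ.deg m) = m := by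
  obtain ⟨e, he⟩ := x.seg_add (Λ.deg l) (Λ.deg m)
  rw [deg_comp, he]
  constructor
  · intro h'
    exact Λ.comp_injective h' (by simp)
  · rintro ⟨h₁, h₂⟩
    congr 1

end InfPath

/-! ### Hereditary sets, avoiding paths and König's lemma -/

/-- A set of vertices is hereditary if it contains the source of each path with range in it. -/
def IsHereditary (H : Set V) : Prop := ∀ x : Quiver.Total V, x.right ∈ H → x.left ∈ H

/-- An infinite path avoids `H` if it has no vertex in `H`. -/
def InfPath.Avoids {Λ : KGraph k V} (x : Λ.InfPath) (H : Set V) : Prop :=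
  ∀ n, (x.seg n).left ∉ H

namespace InfPath

variable {Λ} {H : Set V}

lemma Avoids.range_notMem {x : Λ.InfPath} (hx : x.Avoids H) : x.range ∉ H := by
  have := hx 0
  rwa [left_eq_right Λ (x.deg_seg 0)] at this

lemma Avoids.shift {x : Λ.InfPath} (hx : x.Avoids H) (p : Fin k → ℕ) : (x.shift p).Avoids H := by
  intro n
  simp only [InfPath.shift]
  rw [suf_left (by simp)]
  exact hx _

/-- From every vertex of `lx` a further segment leads to a vertex of `x`; were the former in the
hereditary set, so would be the latter. -/
lemma Avoids.cons (hH : IsHereditary H) {x : Λ.InfPath} (hx : x.Avoids H) (l : Quiver.Total V)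
    (h : l.left = x.range) : (cons l x h).Avoids H := by
  intro n hn
  have hle : n ≤ Λ.deg (comp l (x.seg n) (h.trans (x.seg_right n).symm)) := by simp
  simp only [InfPath.cons] at hn
  rw [← suf_right hle] at hn
  have := hH _ hn
  rw [suf_left hle] at this
  exact hx n this

end InfPath

/-- König's lemma for an inverse system of finite nonempty sets whose transition maps depend only
on their target. -/
lemma _root_.Preorder.exists_compatible_family {J : Type*} [Preorder J] [IsDirectedOrder J]
    {α : Type*} (T : J → Set α) (hfin : ∀ n, (T n).Finite) (hne : ∀ n, (T n).Nonempty)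
    (f : J → α → α) (hf : ∀ {m n}, m ≤ n → ∀ x ∈ T n, f m x ∈ T m)
    (hid : ∀ n, ∀ x ∈ T n, f n x = x)
    (hcomp : ∀ {l m n}, l ≤ m → m ≤ n → ∀ x ∈ T n, f l (f m x) = f l x) :
    ∃ x : J → α, (∀ n, x n ∈ T n) ∧ ∀ {m n}, m ≤ n → f m (x n) = x m := by
  let F : Jᵒᵖ ⥤ Type _ :=
    { obj := fun n => T n.unop
      map := fun {m n} g => TypeCat.ofHom fun x => ⟨f n.unop x.1, hf (leOfHom g.unop) x.1 x.2⟩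
      map_id := fun n => by
        ext x
        exact hid _ x.1 x.2
      map_comp := fun {l m n} g h => by
        ext x
        exact (hcomp (leOfHom h.unop) (leOfHom g.unop) x.1 x.2).symm }
  have : ∀ j, Finite (F.obj j) := fun j => (hfin j.unop).to_subtype
  have : ∀ j, Nonempty (F.obj j) := fun j => (hne j.unop).to_subtype
  obtain ⟨x, hx⟩ := nonempty_sections_of_finite_inverse_system F
  exact ⟨fun n => (x (Opposite.op n)).1, fun n => (x (Opposite.op n)).2,
    fun {m n} hmn => congrArg Subtype.val (hx (homOfLE hmn).op)⟩

/-- König's lemma: if for each `n` some path of degree `n` with range `a` has its source outside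
the hereditary set `H`, then some infinite path with range `a` avoids `H`. -/
lemma exists_infPath_avoids (hrow : Λ.RowFinite) {H : Set V} (hH : IsHereditary H) (a : V)
    (ha : ∀ n, ∃ x : Quiver.Total V, x.right = a ∧ Λ.deg x = n ∧ x.left ∉ H) :
    ∃ x : Λ.InfPath, x.range = a ∧ x.Avoids H := by
  let T : (Fin k → ℕ) → Set (Quiver.Total V) := fun n =>
    {x | x.right = a ∧ Λ.deg x = n ∧ x.left ∉ H}
  -- An initial segment cannot end in `H`: the rest of the path would then stay in `H` up to its
  -- source.
  have hT : ∀ {m n : Fin k → ℕ}, m ≤ n → ∀ x ∈ T n, Λ.pre m x ∈ T m := by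
    rintro m n hmn x ⟨h₁, h₂, h₃⟩
    have hle : m ≤ Λ.deg x := h₂ ▸ hmn
    refine ⟨(pre_right hle).trans h₁, deg_pre hle, fun h₄ => h₃ ?_⟩
    rw [← suf_right hle] at h₄
    rw [← suf_left hle]
    exact hH _ h₄
  obtain ⟨x, hx, hp⟩ := Preorder.exists_compatible_family T
    (fun n => (hrow a n).subset fun x hx => ⟨hx.1, hx.2.1⟩) ha Λ.pre hT
    (fun n x hx => Λ.pre_self hx.2.1) fun hlm hmn x hx => pre_pre_of_le hlm (hx.2.1.symm ▸ hmn)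
  exact ⟨⟨x, fun n => (hx n).2.1, hp⟩, (hx 0).1, fun n => (hx n).2.2⟩

/-! ### Kumjian-Pask families -/

/-- A Kumjian-Pask `Λ`-family `(P, S, T)` in a ring, where `Λ` is row-finite without sources:
`P a` is the idempotent of the vertex `a`, and `S x`, `T x` are the elements of the path `x` and of
its ghost path. -/
structure IsKPFamily {B : Type*} [NonUnitalRing B] (P : V → B) (S T : Quiver.Total V → B) :
    Prop where
  path_id (a : V) : S (idPath a) = P a
  ghost_id (a : V) : T (idPath a) = P a
  orth {a b : V} (h : a ≠ b) : P a * P b = 0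
  path_mul_path (x y : Quiver.Total V) (h : x.left = y.right) : S x * S y = S (comp x y h)
  ghost_mul_ghost (x y : Quiver.Total V) (h : x.left = y.right) : T y * T x = T (comp x y h)
  ghost_mul_path_self (x : Quiver.Total V) : T x * S x = P x.left
  ghost_mul_path_ne {x y : Quiver.Total V} (h : Λ.deg x = Λ.deg y) (hne : x ≠ y) : T x * S y = 0
  vertex_eq_sum (a : V) (n : Fin k → ℕ) (F : Finset (Quiver.Total V))
    (hF : ∀ x, x ∈ F ↔ x.right = a ∧ Λ.deg x = n) : P a = ∑ x ∈ F, S x * T x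

namespace IsKPFamily

variable {Λ} {B : Type*} [NonUnitalRing B] {P : V → B} {S T : Quiver.Total V → B}

lemma idem (hB : Λ.IsKPFamily P S T) (a : V) : P a * P a = P a := by
  rw [← hB.path_id, hB.path_mul_path _ _ rfl, comp_idPath]

lemma vertex_mul_path (hB : Λ.IsKPFamily P S T) (x : Quiver.Total V) : P x.right * S x = S x := by
  rw [← hB.path_id, hB.path_mul_path _ _ rfl, idPath_comp]

lemma path_mul_vertex (hB : Λ.IsKPFamily P S T) (x : Quiver.Total V) : S x * P x.left = S x := by
  rw [← hB.path_id, hB.path_mul_path _ _ rfl, comp_idPath]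

lemma vertex_mul_ghost (hB : Λ.IsKPFamily P S T) (x : Quiver.Total V) : P x.left * T x = T x := by
  rw [← hB.ghost_id, hB.ghost_mul_ghost _ _ rfl, comp_idPath]

lemma ghost_mul_vertex (hB : Λ.IsKPFamily P S T) (x : Quiver.Total V) : T x * P x.right = T x := by
  rw [← hB.ghost_id, hB.ghost_mul_ghost _ _ rfl, idPath_comp]

lemma vertex_mul_path_ne (hB : Λ.IsKPFamily P S T) {a : V} {x : Quiver.Total V}
    (h : a ≠ x.right) : P a * S x = 0 := by
  rw [← hB.vertex_mul_path, ← mul_assoc, hB.orth h, zero_mul]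

lemma ghost_mul_vertex_ne (hB : Λ.IsKPFamily P S T) {a : V} {x : Quiver.Total V}
    (h : x.right ≠ a) : T x * P a = 0 := by
  rw [← hB.ghost_mul_vertex, mul_assoc, hB.orth h, mul_zero]

lemma path_mul_path_ne (hB : Λ.IsKPFamily P S T) {x y : Quiver.Total V} (h : x.left ≠ y.right) :
    S x * S y = 0 := by
  rw [← hB.path_mul_vertex, mul_assoc, hB.vertex_mul_path_ne h, mul_zero]

lemma ghost_mul_ghost_ne (hB : Λ.IsKPFamily P S T) {x y : Quiver.Total V} (h : x.left ≠ y.right) :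
    T y * T x = 0 := by
  rw [← hB.vertex_mul_ghost x, ← mul_assoc, hB.ghost_mul_vertex_ne h.symm, zero_mul]

lemma path_mul_ghost_ne (hB : Λ.IsKPFamily P S T) {x y : Quiver.Total V} (h : x.left ≠ y.left) :
    S x * T y = 0 := by
  rw [← hB.path_mul_vertex, ← hB.vertex_mul_ghost y, mul_assoc, ← mul_assoc (P x.left),
    hB.orth h, zero_mul, mul_zero]

lemma ghost_mul_path (hB : Λ.IsKPFamily P S T) {x y : Quiver.Total V}
    (h : Λ.deg x = Λ.deg y) [Decidable (x = y)] : T x * S y = if x = y then P x.left else 0 := by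
  split_ifs with e
  · rw [← e, hB.ghost_mul_path_self]
  · exact hB.ghost_mul_path_ne h e

/-- The product of a ghost path and a path of greater degree is zero or a path. -/
lemma ghost_mul_path_of_le (hB : Λ.IsKPFamily P S T) {x z : Quiver.Total V}
    (h : Λ.deg x ≤ Λ.deg z) : T x * S z = 0 ∨ T x * S z = S (Λ.suf (Λ.deg x) z) := by
  classical
  obtain ⟨e, h₁, h₂, -⟩ := pre_suf h
  rw [← h₁, ← hB.path_mul_path, ← mul_assoc, hB.ghost_mul_path h₂.symm]
  split_ifs with hx
  · right
    have hl : x.left = (Λ.suf (Λ.deg x) z).right := (congrArg Quiver.Total.left hx).trans e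
    rw [Λ.suf_comp e h₂, hl, hB.vertex_mul_path]
  · left
    rw [zero_mul]

/-- The product of a ghost path of greater degree and a path is zero or a ghost path. -/
lemma ghost_mul_path_of_ge (hB : Λ.IsKPFamily P S T) {x z : Quiver.Total V}
    (h : Λ.deg x ≤ Λ.deg z) : T z * S x = 0 ∨ T z * S x = T (Λ.suf (Λ.deg x) z) := by
  classical
  obtain ⟨e, h₁, h₂, -⟩ := pre_suf h
  rw [← h₁, ← hB.ghost_mul_ghost, mul_assoc, hB.ghost_mul_path h₂]
  split_ifs with hx
  · right
    rw [Λ.suf_comp e h₂, e, hB.ghost_mul_vertex]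
  · left
    rw [mul_zero]

end IsKPFamily

/-! ### The universal family and its universal property -/

section Lift

variable (R : Type w) [CommRing R]

/-- Without sources a path whose degree falls short of `n` in some coordinate can be prolonged
there, which the definition of `Λ^{≤ n}` forbids. -/
lemma mem_pathsLE_iff {Λ : KGraph k V} (hsrc : Λ.NoSources) {n : Fin k → ℕ}
    {x : Quiver.Total V} : x ∈ Λ.pathsLE n ↔ Λ.deg x = n := by
  constructor
  · rintro ⟨h₁, h₂⟩
    refine le_antisymm h₁ fun i => ?_
    by_contra! hi
    refine h₂ i (fun j => ?_) (hsrc _ _)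
    rcases eq_or_ne j i with rfl | hj
    · simpa [deg] using hi
    · simpa [hj] using h₁ j
  · rintro rfl
    refine ⟨le_rfl, fun i hi => ?_⟩
    have := hi i
    simp [deg] at this

/-- The generator of `UnitalKP` for a generator of the Kumjian-Pask algebra. -/
def unitalGen (g : KPGen V) : Λ.UnitalKP R :=
  RingQuot.mkAlgHom R (Λ.KPRel R) (FreeAlgebra.ι R g)

/-- The defining relations 3 and 4 are imposed only for `n ≠ 0`; in degree `0` all paths are
vertices, and the claims reduce to relation 1. -/
lemma isKPFamily_unitalGen (hsrc : Λ.NoSources) :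
    Λ.IsKPFamily (fun a => Λ.unitalGen R (KPGen.vertex a)) (fun x => Λ.unitalGen R (KPGen.path x))
      (fun x => Λ.unitalGen R (KPGen.ghost x)) where
  path_id a := RingQuot.mkAlgHom_rel R (KPRel.path_id a)
  ghost_id a := RingQuot.mkAlgHom_rel R (KPRel.ghost_id a)
  orth h := by
    have := RingQuot.mkAlgHom_rel R (KPRel.kp1_orth (Λ := Λ) (R := R) _ _ h)
    rwa [map_mul, map_zero] at this
  path_mul_path := by
    rintro ⟨b, c, f⟩ ⟨a, b', g⟩ h
    obtain rfl : b = b' := h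
    have := RingQuot.mkAlgHom_rel R (KPRel.kp2_path (Λ := Λ) (R := R) f g)
    rw [map_mul] at this
    rw [comp_mk]
    exact this
  ghost_mul_ghost := by
    rintro ⟨b, c, f⟩ ⟨a, b', g⟩ h
    obtain rfl : b = b' := h
    have := RingQuot.mkAlgHom_rel R (KPRel.kp2_ghost (Λ := Λ) (R := R) f g)
    rw [map_mul] at this
    rw [comp_mk]
    exact this
  ghost_mul_path_self x := by
    by_cases hx : Λ.deg x = 0
    · have h₁ := RingQuot.mkAlgHom_rel R (KPRel.path_id (Λ := Λ) (R := R) x.right)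
      have h₂ := RingQuot.mkAlgHom_rel R (KPRel.ghost_id (Λ := Λ) (R := R) x.right)
      have h₃ := RingQuot.mkAlgHom_rel R (KPRel.kp1_idem (Λ := Λ) (R := R) x.right)
      rw [map_mul] at h₃
      rw [Λ.left_eq_right hx, Λ.eq_idPath_right hx]
      refine Eq.trans ?_ h₃
      exact congrArg₂ (· * ·) h₂ h₁
    · have := RingQuot.mkAlgHom_rel R
        (KPRel.kp3_same (Λ := Λ) (R := R) _ hx x ((mem_pathsLE_iff hsrc).2 rfl))
      rwa [map_mul] at this
  ghost_mul_path_ne {x y} h hne := by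
    by_cases hx : Λ.deg x = 0
    · have hy : Λ.deg y = 0 := h ▸ hx
      have h₁ := RingQuot.mkAlgHom_rel R (KPRel.path_id (Λ := Λ) (R := R) y.right)
      have h₂ := RingQuot.mkAlgHom_rel R (KPRel.ghost_id (Λ := Λ) (R := R) x.right)
      have hxy : x.right ≠ y.right := fun e => hne <| by
        rw [Λ.eq_idPath_right hx, Λ.eq_idPath_right hy, e]
      have h₃ := RingQuot.mkAlgHom_rel R (KPRel.kp1_orth (Λ := Λ) (R := R) _ _ hxy)
      rw [map_mul, map_zero] at h₃
      rw [Λ.eq_idPath_right hx, Λ.eq_idPath_right hy]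
      refine Eq.trans ?_ h₃
      exact congrArg₂ (· * ·) h₂ h₁
    · have := RingQuot.mkAlgHom_rel R (KPRel.kp3_ne (Λ := Λ) (R := R) _ hx x y
        ((mem_pathsLE_iff hsrc).2 rfl) ((mem_pathsLE_iff hsrc).2 h.symm) hne)
      rwa [map_mul, map_zero] at this
  vertex_eq_sum a n F hF := by
    by_cases hn : n = 0
    · subst hn
      have hF' : F = {idPath a} := by
        ext x
        rw [hF, Finset.mem_singleton]
        constructor
        · rintro ⟨rfl, h⟩
          exact Λ.eq_idPath_right h
        · rintro rfl
          simp
      have h₁ := RingQuot.mkAlgHom_rel R (KPRel.path_id (Λ := Λ) (R := R) a)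
      have h₂ := RingQuot.mkAlgHom_rel R (KPRel.ghost_id (Λ := Λ) (R := R) a)
      have h₃ := RingQuot.mkAlgHom_rel R (KPRel.kp1_idem (Λ := Λ) (R := R) a)
      rw [map_mul] at h₃
      rw [hF', Finset.sum_singleton]
      refine Eq.trans h₃.symm ?_
      exact (congrArg₂ (· * ·) h₁ h₂).symm
    · have := RingQuot.mkAlgHom_rel R (KPRel.kp4 (Λ := Λ) (R := R) a n hn F
        (by simpa only [mem_pathsLE_iff hsrc] using hF))
      rw [map_sum] at this
      simp only [map_mul] at this
      exact this

variable {R} {B : Type*} [Ring B] [Algebra R B]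

/-- The value at a generator of the homomorphism defined by a Kumjian-Pask family. -/
def genValue (P : V → B) (S T : Quiver.Total V → B) : KPGen V → B
  | .vertex a => P a
  | .path x => S x
  | .ghost x => T x

variable {Λ} {P : V → B} {S T : Quiver.Total V → B}

/-- The universal property of `UnitalKP`. -/
def IsKPFamily.lift (hsrc : Λ.NoSources) (hB : Λ.IsKPFamily P S T) : Λ.UnitalKP R →ₐ[R] B :=
  RingQuot.liftAlgHom R ⟨FreeAlgebra.lift R (genValue P S T), by
    intro x y h
    induction h with
    | path_id a => simpa [freeS, freeP, genValue] using hB.path_id a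
    | ghost_id a => simpa [freeSs, freeP, genValue] using hB.ghost_id a
    | kp1_idem a => simpa [freeP, genValue] using hB.idem a
    | kp1_orth a b h => simpa [freeP, genValue] using hB.orth h
    | kp2_path f g =>
      simpa [freeS, genValue, comp_mk] using hB.path_mul_path ⟨_, _, f⟩ ⟨_, _, g⟩ rfl
    | kp2_ghost f g =>
      simpa [freeSs, genValue, comp_mk] using hB.ghost_mul_ghost ⟨_, _, f⟩ ⟨_, _, g⟩ rfl
    | kp2_range_path f => simpa [freeS, freeP, genValue] using hB.vertex_mul_path ⟨_, _, f⟩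
    | kp2_path_source f => simpa [freeS, freeP, genValue] using hB.path_mul_vertex ⟨_, _, f⟩
    | kp2_source_ghost f => simpa [freeSs, freeP, genValue] using hB.vertex_mul_ghost ⟨_, _, f⟩
    | kp2_ghost_range f => simpa [freeSs, freeP, genValue] using hB.ghost_mul_vertex ⟨_, _, f⟩
    | kp3_same n hn x hx => simpa [freeS, freeSs, freeP, genValue] using hB.ghost_mul_path_self x
    | kp3_ne n hn x y hx hy hxy =>
      simpa [freeS, freeSs, genValue] using hB.ghost_mul_path_ne
        (((mem_pathsLE_iff hsrc).1 hx).trans ((mem_pathsLE_iff hsrc).1 hy).symm) hxy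
    | kp4 a n hn F hF =>
      simpa [freeS, freeSs, freeP, genValue] using hB.vertex_eq_sum a n F
        (by simpa only [mem_pathsLE_iff hsrc] using hF)⟩

lemma IsKPFamily.lift_unitalGen (hsrc : Λ.NoSources) (hB : Λ.IsKPFamily P S T) (g : KPGen V) :
    hB.lift (R := R) hsrc (Λ.unitalGen R g) = genValue P S T g := by
  rw [IsKPFamily.lift, unitalGen, RingQuot.liftAlgHom_mkAlgHom_apply, FreeAlgebra.lift_ι_apply]

end Lift

/-! ### The representation on functions on infinite paths -/

section InfPathRep

variable (R : Type w) [CommRing R] (H : Set V)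

/-- The infinite paths that avoid `H`. -/
abbrev AvoidingPath : Type (max u v) := {x : Λ.InfPath // x.Avoids H}

open Classical in
/-- The operator of a vertex on the functions on infinite paths. -/
def vertexOp (a : V) : Module.End R (Λ.AvoidingPath H → R) where
  toFun φ x := if x.1.range = a then φ x else 0
  map_add' φ ψ := by ext x; by_cases h : x.1.range = a <;> simp [h]
  map_smul' r φ := by ext x; by_cases h : x.1.range = a <;> simp [h]

open Classical in
/-- The operator of a path on the functions on infinite paths. -/
def pathOp (l : Quiver.Total V) : Module.End R (Λ.AvoidingPath H → R) where
  toFun φ x := if x.1.seg (Λ.deg l) = l then φ ⟨x.1.shift (Λ.deg l), x.2.shift _⟩ else 0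
  map_add' φ ψ := by ext x; by_cases h : x.1.seg (Λ.deg l) = l <;> simp [h]
  map_smul' r φ := by ext x; by_cases h : x.1.seg (Λ.deg l) = l <;> simp [h]

open Classical in
/-- The operator of a ghost path on the functions on infinite paths. -/
def ghostOp (hH : IsHereditary H) (l : Quiver.Total V) :
    Module.End R (Λ.AvoidingPath H → R) where
  toFun φ x := if h : l.left = x.1.range then φ ⟨x.1.cons l h, x.2.cons hH l h⟩ else 0
  map_add' φ ψ := by ext x; by_cases h : l.left = x.1.range <;> simp [h]
  map_smul' r φ := by ext x; by_cases h : l.left = x.1.range <;> simp [h]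

variable {Λ H}

lemma pathOp_ghostOp (hH : IsHereditary H) (l : Quiver.Total V) (φ : Λ.AvoidingPath H → R)
    (x : Λ.AvoidingPath H) [Decidable (x.1.seg (Λ.deg l) = l)] :
    Λ.pathOp R H l (Λ.ghostOp R H hH l φ) x = if x.1.seg (Λ.deg l) = l then φ x else 0 := by
  by_cases h : x.1.seg (Λ.deg l) = l
  · have h₁ : l.left = (x.1.shift (Λ.deg l)).range := by rw [InfPath.range_shift, h]
    have h₂ : (x.1.shift (Λ.deg l)).cons l h₁ = x.1 := by
      have := x.1.cons_shift (Λ.deg l)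
      simpa only [h] using this
    simp [pathOp, ghostOp, h, h₁, h₂]
  · simp [pathOp, h]

/-- On indicator functions `S_l` sends `δ_x` to `δ_{lx}` and `T_l` undoes this. Relation 4 holds
because an infinite path has exactly one initial segment of each degree. -/
lemma isKPFamily_infPath (hH : IsHereditary H) :
    Λ.IsKPFamily (Λ.vertexOp R H) (Λ.pathOp R H) (Λ.ghostOp R H hH) where
  path_id a := by
    ext φ x
    have h : x.1.seg 0 = idPath a ↔ x.1.range = a := by
      rw [Λ.eq_idPath_right (x.1.deg_seg 0)]
      refine ⟨fun h => congrArg Quiver.Total.right h, fun h => ?_⟩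
      rw [← h]
      rfl
    have h' : x.1.shift 0 = x.1 := by
      refine InfPath.ext fun n => ?_
      have := Λ.suf_comp (x := idPath (x.1.seg n).right) (y := x.1.seg n) rfl (n := 0) (by simp)
      rw [idPath_comp] at this
      simpa [InfPath.shift] using this
    have hs : x.1.seg (Λ.deg (idPath a)) = idPath a ↔ x.1.range = a := by rw [deg_idPath, h]
    by_cases ha : x.1.range = a
    · simp only [pathOp, vertexOp, LinearMap.coe_mk, AddHom.coe_mk, if_pos ha, if_pos (hs.2 ha)]
      simp [h']
    · simp only [pathOp, vertexOp, LinearMap.coe_mk, AddHom.coe_mk, if_neg ha, if_neg (mt hs.1 ha)]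
  ghost_id a := by
    ext φ x
    by_cases h : x.1.range = a
    · have h' : x.1.cons (idPath a) h.symm = x.1 := by
        refine InfPath.ext fun n => ?_
        simp [InfPath.cons, Λ.pre_self]
      simp [ghostOp, vertexOp, h, h']
    · simp [ghostOp, vertexOp, h, Ne.symm h]
  orth {a b} h := by
    ext φ x
    by_cases h₁ : x.1.range = a
    · simp [vertexOp, h₁, h]
    · simp [vertexOp, h₁]
  path_mul_path l m h := by
    ext φ x
    have := x.1.seg_deg_comp_iff l m h
    by_cases h₁ : x.1.seg (Λ.deg l) = l
    · by_cases h₂ : (x.1.shift (Λ.deg l)).seg (Λ.deg m) = m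
      · simp [pathOp, h₁, h₂, this.2 ⟨h₁, h₂⟩, InfPath.shift_shift, -deg_comp, ← Λ.deg_comp l m h]
      · simp [pathOp, h₂, this, -deg_comp]
    · simp [pathOp, h₁, this, -deg_comp]
  ghost_mul_ghost l m h := by
    ext φ x
    by_cases h₁ : m.left = x.1.range
    · have h₂ : l.left = (x.1.cons m h₁).range := by rw [InfPath.range_cons, h]
      simp [ghostOp, h₁, h₂]
      exact congrArg φ (Subtype.ext (InfPath.cons_cons l m x.1 h h₁))
    · simp [ghostOp, h₁]
  ghost_mul_path_self l := by
    ext φ x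
    by_cases h₁ : l.left = x.1.range
    · simp [ghostOp, pathOp, vertexOp, h₁, InfPath.seg_cons, InfPath.shift_cons]
    · simp [ghostOp, vertexOp, h₁, Ne.symm h₁]
  ghost_mul_path_ne {l m} h hne := by
    ext φ x
    by_cases h₁ : l.left = x.1.range
    · simp [ghostOp, pathOp, h₁, ← h, InfPath.seg_cons, hne]
    · simp [ghostOp, h₁]
  vertex_eq_sum a n F hF := by
    classical
    ext φ x
    have h : ∀ l ∈ F, (Λ.pathOp R H l * Λ.ghostOp R H hH l) φ x =
        if x.1.seg n = l then φ x else 0 := by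
      intro l hl
      rw [Module.End.mul_apply, pathOp_ghostOp, ((hF l).1 hl).2]
    rw [LinearMap.sum_apply, Finset.sum_apply, Finset.sum_congr rfl h, Finset.sum_ite_eq]
    simp [hF, vertexOp, InfPath.seg_right]

end InfPathRep

/-! ### Spanning sets -/

/-- The paths of degree `n` with range `a`. -/
def pathFinset (hrow : Λ.RowFinite) (a : V) (n : Fin k → ℕ) : Finset (Quiver.Total V) :=
  (hrow a n).toFinset

lemma mem_pathFinset {Λ : KGraph k V} (hrow : Λ.RowFinite) {a : V} {n : Fin k → ℕ}
    {x : Quiver.Total V} : x ∈ Λ.pathFinset hrow a n ↔ x.right = a ∧ Λ.deg x = n :=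
  Set.Finite.mem_toFinset _

/-- The degree of a path as an element of `ℤ^k`. -/
def intDeg (x : Quiver.Total V) : Fin k → ℤ := fun i => (Λ.deg x i : ℤ)

lemma intDeg_comp (x y : Quiver.Total V) (h : x.left = y.right) :
    Λ.intDeg (comp x y h) = Λ.intDeg x + Λ.intDeg y := by
  ext i
  simp [intDeg]

lemma intDeg_eq {Λ : KGraph k V} {x y : Quiver.Total V} (h : Λ.intDeg x = Λ.intDeg y) :
    Λ.deg x = Λ.deg y := by
  ext i
  exact Int.ofNat.inj (congrFun h i)

/-- The pairs `(x, y)` of paths with the same source, `d(x) - d(y) = n` and `d(y) = N`. -/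
def levelPairs (n : Fin k → ℤ) (N : Fin k → ℕ) : Set (Quiver.Total V × Quiver.Total V) :=
  {q | q.1.left = q.2.left ∧ Λ.intDeg q.1 - Λ.intDeg q.2 = n ∧ Λ.deg q.2 = N}

namespace IsKPFamily

variable {Λ} {R : Type w} [CommRing R] {B : Type*} [NonUnitalRing B] [Module R B]
  {P : V → B} {S T : Quiver.Total V → B}

/-- Insert `p_{r(y)} = ∑ s_l s_{l*}` with `d(l) = d(y) + d(z)` between `s_{y*}` and `s_z`. Each `l`
is then long enough to absorb both, leaving a path times a ghost path. -/
lemma path_mul_ghost_mul (hrow : Λ.RowFinite) (hB : Λ.IsKPFamily P S T)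
    (x y z t : Quiver.Total V) :
    S x * T y * (S z * T t) ∈
      Submodule.span R (Set.range fun q : Quiver.Total V × Quiver.Total V => S q.1 * T q.2) := by
  have h₁ : T y * S z =
      ∑ l ∈ Λ.pathFinset hrow y.right (Λ.deg y + Λ.deg z), (T y * S l) * (T l * S z) := by
    conv_lhs => rw [← hB.ghost_mul_vertex, mul_assoc]
    rw [hB.vertex_eq_sum _ _ _ fun x => mem_pathFinset hrow,
      Finset.sum_mul, Finset.mul_sum]
    exact Finset.sum_congr rfl fun l _ => by simp only [mul_assoc]
  have h₂ : S x * T y * (S z * T t) = S x * (T y * S z) * T t := by simp only [mul_assoc]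
  rw [h₂, h₁, Finset.mul_sum, Finset.sum_mul]
  refine Submodule.sum_mem _ fun l hl => ?_
  have hd := ((mem_pathFinset hrow).1 hl).2
  have h₃ : S x * (T y * S l * (T l * S z)) * T t = (S x * (T y * S l)) * ((T l * S z) * T t) := by
    simp only [mul_assoc]
  rw [h₃]
  rcases hB.ghost_mul_path_of_le (x := y) (z := l) (hd ▸ le_self_add) with h₄ | h₄
  · rw [h₄]; simp
  rcases hB.ghost_mul_path_of_ge (x := z) (z := l) (hd ▸ le_add_self) with h₅ | h₅
  · rw [h₅]; simp
  rw [h₄, h₅]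
  by_cases h₆ : x.left = (Λ.suf (Λ.deg y) l).right
  · by_cases h₇ : t.left = (Λ.suf (Λ.deg z) l).right
    · rw [hB.path_mul_path _ _ h₆, hB.ghost_mul_ghost _ _ h₇]
      exact Submodule.subset_span ⟨(_, _), rfl⟩
    · rw [hB.ghost_mul_ghost_ne h₇]; simp
  · rw [hB.path_mul_path_ne h₆]; simp

lemma path_mul_ghost_eq_sum (hrow : Λ.RowFinite) (hB : Λ.IsKPFamily P S T)
    {x y : Quiver.Total V} (h : x.left = y.left) (n : Fin k → ℕ) :
    S x * T y = ∑ l ∈ (Λ.pathFinset hrow x.left n).attach,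
      S (comp x l.1 ((mem_pathFinset hrow).1 l.2).1.symm) *
        T (comp y l.1 (h.symm.trans ((mem_pathFinset hrow).1 l.2).1.symm)) := by
  rw [← hB.path_mul_vertex, hB.vertex_eq_sum _ n _ fun x => mem_pathFinset hrow,
    Finset.mul_sum, Finset.sum_mul, ← Finset.sum_attach]
  refine Finset.sum_congr rfl fun l _ => ?_
  rw [← hB.path_mul_path, ← hB.ghost_mul_ghost]
  simp only [mul_assoc]

/-- Prolonging `x` and `y` by the same `l` keeps `d(x) - d(y)`. This brings finitely many terms of
equal degree to a common degree of their ghost parts. -/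
lemma span_levelPairs_mono (hrow : Λ.RowFinite) (hB : Λ.IsKPFamily P S T) (n : Fin k → ℤ)
    {M N : Fin k → ℕ} (h : M ≤ N) :
    Submodule.span R ((fun q => S q.1 * T q.2) '' Λ.levelPairs n M) ≤
      Submodule.span R ((fun q => S q.1 * T q.2) '' Λ.levelPairs n N) := by
  rw [Submodule.span_le]
  rintro _ ⟨⟨x, y⟩, ⟨h₁, h₂, h₃⟩, rfl⟩
  simp only at h₁ h₂ h₃ ⊢
  rw [hB.path_mul_ghost_eq_sum hrow h₁ (N - M)]
  refine Submodule.sum_mem _ fun l _ => Submodule.subset_span ?_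
  have hl := ((mem_pathFinset hrow).1 l.2).1.symm
  refine ⟨(comp x l.1 hl, comp y l.1 (h₁.symm.trans hl)), ⟨rfl, ?_, ?_⟩, rfl⟩
  · simp only [intDeg_comp, add_sub_add_right_eq_sub, h₂]
  · simp only [deg_comp, h₃, ((mem_pathFinset hrow).1 l.2).2, add_tsub_cancel_of_le h]

variable [IsScalarTower R B B] [SMulCommClass R B B]

/-- A nonzero element of degree `n` is compressed to a multiple of a vertex idempotent by suitable
paths. -/
lemma exists_ghost_mul_mul_path_eq_smul (hB : Λ.IsKPFamily P S T) (n : Fin k → ℤ)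
    (N : Fin k → ℕ) {z : B} (hz : z ≠ 0)
    (hzn : z ∈ Submodule.span R ((fun q => S q.1 * T q.2) '' Λ.levelPairs n N)) :
    ∃ (x y : Quiver.Total V) (r : R), x.left = y.left ∧ Λ.intDeg x - Λ.intDeg y = n ∧ r ≠ 0 ∧
      T x * z * S y = r • P x.left := by
  classical
  obtain ⟨c, hc, rfl⟩ := (Finsupp.mem_span_image_iff_linearCombination R).1 hzn
  have hc₀ : c ≠ 0 := fun h => hz (by simp [h])
  obtain ⟨⟨x, y⟩, hxy⟩ := Finsupp.support_nonempty_iff.2 hc₀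
  have hl : ∀ q ∈ c.support, q ∈ Λ.levelPairs n N := fun q hq => hc hq
  obtain ⟨h₁, h₂, h₃⟩ := hl _ hxy
  simp only at h₁ h₂ h₃
  refine ⟨x, y, c (x, y), h₁, h₂, Finsupp.mem_support_iff.1 hxy, ?_⟩
  rw [Finsupp.linearCombination_apply, Finsupp.sum, Finset.mul_sum, Finset.sum_mul,
    Finset.sum_eq_single (x, y)]
  · simp only [mul_smul_comm, smul_mul_assoc]
    rw [← mul_assoc, hB.ghost_mul_path_self, mul_assoc, hB.ghost_mul_path_self, ← h₁,
      hB.idem]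
  · rintro ⟨x', y'⟩ hq hne
    obtain ⟨h₁', h₂', h₃'⟩ := hl _ hq
    simp only at h₁' h₂' h₃'
    -- All ghost parts have degree `N`, so `y' ≠ y` gives zero on the right. If `y' = y`, then `x'`
    -- and `x` are distinct paths of equal degree, which gives zero on the left.
    have h₄ : T x * S x' * (T y' * S y) = 0 := by
      by_cases hy : y' = y
      · have hx : x ≠ x' := fun hx => hne (by rw [hx, hy])
        rw [hB.ghost_mul_path_ne _ hx, zero_mul]
        refine intDeg_eq ?_
        rw [sub_eq_iff_eq_add.1 h₂, sub_eq_iff_eq_add.1 h₂', hy]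
      · rw [hB.ghost_mul_path_ne (h₃'.trans h₃.symm) hy, mul_zero]
    simp only [mul_smul_comm, smul_mul_assoc]
    rw [← mul_assoc, mul_assoc (T x * S x'), h₄, smul_zero]
  · exact fun h => absurd hxy h

end IsKPFamily

/-! ### The coaction of the grading group -/

section Coaction

variable {Λ} {B : Type*} [Ring B] {P : V → B} {S T : Quiver.Total V → B}

/-- The relations are homogeneous, so marking each generator with its degree gives a new family; the
universal property turns it into the coaction. -/
lemma IsKPFamily.graded (hB : Λ.IsKPFamily P S T) :
    Λ.IsKPFamily (B := AddMonoidAlgebra B (Fin k → ℤ)) (fun a => .single 0 (P a))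
      (fun x => .single (Λ.intDeg x) (S x)) (fun x => .single (-Λ.intDeg x) (T x)) where
  path_id a := by
    have : Λ.intDeg (idPath a) = 0 := by ext i; simp [intDeg]
    rw [this, hB.path_id]
  ghost_id a := by
    have : Λ.intDeg (idPath a) = 0 := by ext i; simp [intDeg]
    rw [this, hB.ghost_id, neg_zero]
  orth h := by rw [AddMonoidAlgebra.single_mul_single, hB.orth h, AddMonoidAlgebra.single_zero]
  path_mul_path x y h := by
    rw [AddMonoidAlgebra.single_mul_single, hB.path_mul_path x y h, intDeg_comp]
  ghost_mul_ghost x y h := by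
    rw [AddMonoidAlgebra.single_mul_single, hB.ghost_mul_ghost x y h, intDeg_comp, neg_add_rev]
  ghost_mul_path_self x := by
    rw [AddMonoidAlgebra.single_mul_single, hB.ghost_mul_path_self, neg_add_cancel]
  ghost_mul_path_ne h hne := by
    rw [AddMonoidAlgebra.single_mul_single, hB.ghost_mul_path_ne h hne,
      AddMonoidAlgebra.single_zero]
  vertex_eq_sum a n F hF := by
    simp only [AddMonoidAlgebra.single_mul_single, add_neg_cancel]
    rw [hB.vertex_eq_sum a n F hF]
    exact map_sum (AddMonoidAlgebra.singleAddHom (0 : Fin k → ℤ)) _ _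

end Coaction

/-! ### Spanning elements, compression and homogeneous parts in the Kumjian-Pask algebra -/

section KP

variable {Λ} (R : Type w) [CommRing R]

lemma isKPFamily_gen (hsrc : Λ.NoSources) :
    Λ.IsKPFamily (Λ.p R) (Λ.s R) (Λ.sStar R) where
  path_id a := Subtype.ext ((Λ.isKPFamily_unitalGen R hsrc).path_id a)
  ghost_id a := Subtype.ext ((Λ.isKPFamily_unitalGen R hsrc).ghost_id a)
  orth h := Subtype.ext ((Λ.isKPFamily_unitalGen R hsrc).orth h)
  path_mul_path x y h := Subtype.ext ((Λ.isKPFamily_unitalGen R hsrc).path_mul_path x y h)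
  ghost_mul_ghost x y h := Subtype.ext ((Λ.isKPFamily_unitalGen R hsrc).ghost_mul_ghost x y h)
  ghost_mul_path_self x := Subtype.ext ((Λ.isKPFamily_unitalGen R hsrc).ghost_mul_path_self x)
  ghost_mul_path_ne h hne := Subtype.ext ((Λ.isKPFamily_unitalGen R hsrc).ghost_mul_path_ne h hne)
  vertex_eq_sum a n F hF := Subtype.ext <| by
    refine ((Λ.isKPFamily_unitalGen R hsrc).vertex_eq_sum a n F hF).trans ?_
    rw [AddSubmonoidClass.coe_finsetSum]
    rfl

variable {R}

lemma span_path_mul_ghost (hrow : Λ.RowFinite) (hsrc : Λ.NoSources) (z : Λ.KP R) :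
    z ∈ Submodule.span R
      (Set.range fun q : Quiver.Total V × Quiver.Total V => Λ.s R q.1 * Λ.sStar R q.2) := by
  have hB := isKPFamily_gen (Λ := Λ) R hsrc
  obtain ⟨z, hz⟩ := z
  induction hz using NonUnitalAlgebra.adjoin_induction with
  | mem x hx =>
    obtain ⟨g, rfl⟩ := hx
    change Λ.gen R g ∈ _
    refine Submodule.subset_span ?_
    cases g with
    | vertex a =>
      refine ⟨(idPath a, idPath a), ?_⟩
      simp only
      rw [hB.path_id, hB.ghost_id, hB.idem]
      rfl
    | path x =>
      refine ⟨(x, idPath x.left), ?_⟩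
      simp only
      rw [hB.ghost_id, hB.path_mul_vertex]
      rfl
    | ghost x =>
      refine ⟨(idPath x.left, x), ?_⟩
      simp only
      rw [hB.path_id, hB.vertex_mul_ghost]
      rfl
  | add x y hx hy h₁ h₂ => exact Submodule.add_mem _ h₁ h₂
  | zero => exact Submodule.zero_mem _
  | smul r x hx h => exact Submodule.smul_mem _ r h
  | mul x y hx hy h₁ h₂ =>
    change (⟨x, hx⟩ : Λ.KP R) * ⟨y, hy⟩ ∈ _
    generalize (⟨x, hx⟩ : Λ.KP R) = x at *
    generalize (⟨y, hy⟩ : Λ.KP R) = y at *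
    induction h₁ using Submodule.span_induction with
    | zero => rw [zero_mul]; exact Submodule.zero_mem _
    | add a b _ _ ha hb => rw [add_mul]; exact Submodule.add_mem _ ha hb
    | smul r a _ ha => rw [smul_mul_assoc]; exact Submodule.smul_mem _ r ha
    | mem a ha =>
      obtain ⟨q, rfl⟩ := ha
      induction h₂ using Submodule.span_induction with
      | zero => rw [mul_zero]; exact Submodule.zero_mem _
      | add a b _ _ ha hb => rw [mul_add]; exact Submodule.add_mem _ ha hb
      | smul r a _ ha => rw [mul_smul_comm]; exact Submodule.smul_mem _ r ha
      | mem b hb =>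
        obtain ⟨q', rfl⟩ := hb
        exact hB.path_mul_ghost_mul hrow _ _ _ _

lemma path_mul_ghost_mem_component (x y : Quiver.Total V) :
    Λ.s R x * Λ.sStar R y ∈ Λ.component R (Λ.intDeg x - Λ.intDeg y) :=
  Submodule.subset_span ⟨x, y, fun _ => rfl, rfl⟩

lemma exists_mem_span_levelPairs (hrow : Λ.RowFinite) (hsrc : Λ.NoSources) {n : Fin k → ℤ}
    {z : Λ.KP R} (hz : z ∈ Λ.component R n) :
    ∃ N, z ∈ Submodule.span R ((fun q => Λ.s R q.1 * Λ.sStar R q.2) '' Λ.levelPairs n N) := by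
  have hB := isKPFamily_gen (Λ := Λ) R hsrc
  induction hz using Submodule.span_induction with
  | zero => exact ⟨0, Submodule.zero_mem _⟩
  | add x y _ _ hx hy =>
    obtain ⟨M, hM⟩ := hx
    obtain ⟨N, hN⟩ := hy
    exact ⟨M + N, Submodule.add_mem _ (hB.span_levelPairs_mono hrow n le_self_add hM)
      (hB.span_levelPairs_mono hrow n le_add_self hN)⟩
  | smul r x _ hx =>
    obtain ⟨N, hN⟩ := hx
    exact ⟨N, Submodule.smul_mem _ r hN⟩
  | mem z hz =>
    obtain ⟨x, y, h, rfl⟩ := hz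
    by_cases hxy : x.left = y.left
    · exact ⟨Λ.deg y, Submodule.subset_span ⟨(x, y), ⟨hxy, funext h, rfl⟩, rfl⟩⟩
    · rw [hB.path_mul_ghost_ne hxy]
      exact ⟨0, Submodule.zero_mem _⟩

/-- A nonzero homogeneous element is compressed to a multiple of a vertex idempotent by suitable
paths. -/
lemma exists_sStar_mul_mul_s_eq_smul (hrow : Λ.RowFinite) (hsrc : Λ.NoSources) {n : Fin k → ℤ}
    {z : Λ.KP R} (hz : z ∈ Λ.component R n) (hz₀ : z ≠ 0) :
    ∃ (x y : Quiver.Total V) (r : R), x.left = y.left ∧ Λ.intDeg x - Λ.intDeg y = n ∧ r ≠ 0 ∧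
      Λ.sStar R x * z * Λ.s R y = r • Λ.p R x.left := by
  obtain ⟨N, hN⟩ := exists_mem_span_levelPairs hrow hsrc hz
  exact (isKPFamily_gen R hsrc).exists_ghost_mul_mul_path_eq_smul n N hz₀ hN

/-- The coaction of `ℤ^k` that defines the grading. -/
def coaction (hsrc : Λ.NoSources) :
    Λ.UnitalKP R →ₐ[R] AddMonoidAlgebra (Λ.UnitalKP R) (Fin k → ℤ) :=
  (Λ.isKPFamily_unitalGen R hsrc).graded.lift hsrc

lemma coaction_s (hsrc : Λ.NoSources) (x : Quiver.Total V) :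
    coaction hsrc (Λ.s R x : Λ.UnitalKP R) = .single (Λ.intDeg x) (Λ.s R x : Λ.UnitalKP R) :=
  IsKPFamily.lift_unitalGen hsrc _ (KPGen.path x)

lemma coaction_sStar (hsrc : Λ.NoSources) (x : Quiver.Total V) :
    coaction hsrc (Λ.sStar R x : Λ.UnitalKP R) =
      .single (-Λ.intDeg x) (Λ.sStar R x : Λ.UnitalKP R) :=
  IsKPFamily.lift_unitalGen hsrc _ (KPGen.ghost x)

lemma coaction_of_mem_component (hsrc : Λ.NoSources) {n : Fin k → ℤ} {z : Λ.KP R}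
    (hz : z ∈ Λ.component R n) :
    coaction hsrc (z : Λ.UnitalKP R) = .single n (z : Λ.UnitalKP R) := by
  induction hz using Submodule.span_induction with
  | zero => simp
  | add x y _ _ hx hy =>
    rw [NonUnitalSubalgebra.coe_add, map_add, hx, hy, AddMonoidAlgebra.single_add]
  | smul r x _ hx =>
    rw [NonUnitalSubalgebra.coe_smul, map_smul, hx, AddMonoidAlgebra.smul_single]
  | mem z hz =>
    obtain ⟨x, y, h, rfl⟩ := hz
    obtain rfl : Λ.intDeg x - Λ.intDeg y = n := funext h
    rw [NonUnitalSubalgebra.coe_mul, map_mul, coaction_s, coaction_sStar,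
      AddMonoidAlgebra.single_mul_single, sub_eq_add_neg]

/-- Each element is a sum of homogeneous elements, which are its coefficients under the
coaction. -/
lemma exists_coaction_eq_sum (hrow : Λ.RowFinite) (hsrc : Λ.NoSources) (z : Λ.KP R) :
    ∃ f : (Fin k → ℤ) →₀ Λ.KP R, (∀ n, f n ∈ Λ.component R n) ∧ (f.sum fun _ y => y) = z ∧
      ∀ n, (coaction hsrc (z : Λ.UnitalKP R)).coeff n = f n := by
  classical
  have hz := span_path_mul_ghost hrow hsrc z
  induction hz using Submodule.span_induction with
  | zero => exact ⟨0, fun n => Submodule.zero_mem _, by simp, by simp⟩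
  | add x y _ _ hx hy =>
    obtain ⟨f, hf, hf', hf''⟩ := hx
    obtain ⟨g, hg, hg', hg''⟩ := hy
    refine ⟨f + g, fun n => Submodule.add_mem _ (hf n) (hg n), ?_, fun n => ?_⟩
    · rw [Finsupp.sum_add_index' (by simp) (by simp), hf', hg']
    · simp [hf'', hg'']
  | smul r x _ hx =>
    obtain ⟨f, hf, hf', hf''⟩ := hx
    refine ⟨r • f, fun n => Submodule.smul_mem _ r (hf n), ?_, fun n => ?_⟩
    · rw [Finsupp.sum_smul_index' (by simp), ← Finsupp.smul_sum, hf']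
    · simp [hf'']
  | mem z hz =>
    obtain ⟨⟨x, y⟩, rfl⟩ := hz
    have h := path_mul_ghost_mem_component (Λ := Λ) (R := R) x y
    refine ⟨Finsupp.single (Λ.intDeg x - Λ.intDeg y) (Λ.s R x * Λ.sStar R y), fun n => ?_,
      Finsupp.sum_single_index rfl, fun n => ?_⟩
    · rw [Finsupp.single_apply]
      split_ifs with e
      · exact e ▸ h
      · exact Submodule.zero_mem _
    · rw [coaction_of_mem_component hsrc h, AddMonoidAlgebra.coeff_single, Finsupp.single_apply,
        Finsupp.single_apply]
      split_ifs <;> rfl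

end KP

/-! ### Graded ideals from hereditary sets -/

section Ideals

variable {Λ} (R : Type w) [CommRing R]

/-- The infinite path representation. -/
def infPathRep (hsrc : Λ.NoSources) {H : Set V} (hH : IsHereditary H) :
    Λ.UnitalKP R →ₐ[R] Module.End R (Λ.AvoidingPath H → R) :=
  (isKPFamily_infPath R hH).lift hsrc

lemma infPathRep_p (hsrc : Λ.NoSources) {H : Set V} (hH : IsHereditary H) (a : V) :
    infPathRep R hsrc hH (Λ.p R a : Λ.UnitalKP R) = Λ.vertexOp R H a :=
  IsKPFamily.lift_unitalGen hsrc _ (KPGen.vertex a)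

lemma vertexOp_eq_zero {H : Set V} {a : V} (ha : ∀ x : Λ.InfPath, x.Avoids H → x.range ≠ a) :
    Λ.vertexOp R H a = 0 := by
  ext φ x
  simp [vertexOp, ha x.1 x.2]

variable {R}

lemma smul_vertexOp_ne_zero {H : Set V} (x : Λ.InfPath) (hx : x.Avoids H) {r : R} (hr : r ≠ 0) :
    r • Λ.vertexOp R H x.range ≠ 0 := by
  intro h
  -- Applied to the constant function `1` and evaluated at `x`, the operator gives `r`.
  have := congrFun (LinearMap.congr_fun h fun _ => 1) ⟨x, hx⟩
  simp [vertexOp] at this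
  exact hr this

lemma isHereditary_empty : IsHereditary (∅ : Set V) := fun _ h => h

/-- With `H = ∅` every infinite path is allowed, and one with range `a` exists as there are no
sources; `r p_a` acts on functions at it as `r`. -/
lemma smul_p_ne_zero (hrow : Λ.RowFinite) (hsrc : Λ.NoSources) (a : V) {r : R} (hr : r ≠ 0) :
    r • Λ.p R a ≠ 0 := by
  obtain ⟨x, rfl, hx⟩ := Λ.exists_infPath_avoids hrow (isHereditary_empty (V := V)) a fun n => by
    obtain ⟨b, f, hf⟩ := hsrc a n
    exact ⟨⟨b, a, f⟩, rfl, hf, id⟩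
  intro h
  refine smul_vertexOp_ne_zero x hx hr ?_
  rw [← infPathRep_p R hsrc isHereditary_empty, ← map_smul, ← NonUnitalSubalgebra.coe_smul, h]
  simp

lemma p_ne_zero [Nontrivial R] (hrow : Λ.RowFinite) (hsrc : Λ.NoSources) (a : V) :
    Λ.p R a ≠ 0 := by
  simpa using smul_p_ne_zero hrow hsrc a (one_ne_zero (α := R))

variable (R) in
/-- The graded representation on functions on the infinite paths that avoid `H`. -/
def gradedRep (hsrc : Λ.NoSources) {H : Set V} (hH : IsHereditary H) :
    Λ.KP R →ₙ+* AddMonoidAlgebra (Module.End R (Λ.AvoidingPath H → R)) (Fin k → ℤ) :=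
  (((AddMonoidAlgebra.mapRingHom (Fin k → ℤ) (infPathRep R hsrc hH).toRingHom).comp
    (coaction hsrc).toRingHom).toNonUnitalRingHom).comp
      (NonUnitalSubsemiringClass.subtype (NonUnitalAlgebra.adjoin R _))

lemma gradedRep_coeff (hsrc : Λ.NoSources) {H : Set V} (hH : IsHereditary H) (z : Λ.KP R)
    (n : Fin k → ℤ) : (gradedRep R hsrc hH z).coeff n =
      infPathRep R hsrc hH ((coaction hsrc (z : Λ.UnitalKP R)).coeff n) := by
  change (AddMonoidAlgebra.mapRingHom (Fin k → ℤ) (infPathRep R hsrc hH).toRingHom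
    (coaction hsrc (z : Λ.UnitalKP R))).coeff n = _
  simp

variable (R) in
/-- The graded ideal defined by a hereditary set. -/
def hereditaryIdeal (hsrc : Λ.NoSources) {H : Set V} (hH : IsHereditary H) :
    TwoSidedIdeal (Λ.KP R) :=
  TwoSidedIdeal.ker (gradedRep R hsrc hH)

lemma mem_hereditaryIdeal (hsrc : Λ.NoSources) {H : Set V} (hH : IsHereditary H) {z : Λ.KP R} :
    z ∈ hereditaryIdeal R hsrc hH ↔
      ∀ n, infPathRep R hsrc hH ((coaction hsrc (z : Λ.UnitalKP R)).coeff n) = 0 := by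
  rw [hereditaryIdeal, TwoSidedIdeal.mem_ker]
  simp only [← gradedRep_coeff]
  exact ⟨fun h n => by rw [h]; rfl, fun h => AddMonoidAlgebra.ext (Finsupp.ext h)⟩

lemma mem_hereditaryIdeal_of_mem_component (hsrc : Λ.NoSources) {H : Set V} (hH : IsHereditary H)
    {n : Fin k → ℤ} {z : Λ.KP R} (hz : z ∈ Λ.component R n) :
    z ∈ hereditaryIdeal R hsrc hH ↔ infPathRep R hsrc hH (z : Λ.UnitalKP R) = 0 := by
  classical
  rw [mem_hereditaryIdeal, coaction_of_mem_component hsrc hz]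
  constructor
  · intro h
    simpa using h n
  · intro h m
    rw [AddMonoidAlgebra.coeff_single, Finsupp.single_apply]
    split_ifs
    · exact h
    · exact map_zero _

/-- The coaction precedes the representation so that an element of the kernel has all its
homogeneous parts killed separately. -/
lemma isGradedIdeal_hereditaryIdeal (hrow : Λ.RowFinite) (hsrc : Λ.NoSources) {H : Set V}
    (hH : IsHereditary H) : Λ.IsGradedIdeal (hereditaryIdeal R hsrc hH) := by
  intro z hz
  obtain ⟨f, hf, hf', hf''⟩ := exists_coaction_eq_sum hrow hsrc z
  rw [← hf']
  refine AddSubgroup.sum_mem _ fun n _ => AddSubgroup.subset_closure ⟨?_, n, hf n⟩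
  rw [mem_hereditaryIdeal_of_mem_component hsrc hH (hf n), ← hf'']
  exact (mem_hereditaryIdeal hsrc hH).1 hz n

lemma p_mem_component (hsrc : Λ.NoSources) (a : V) : Λ.p R a ∈ Λ.component R 0 := by
  have hB := isKPFamily_gen (Λ := Λ) R hsrc
  have := path_mul_ghost_mem_component (Λ := Λ) (R := R) (idPath a) (idPath a)
  rwa [hB.path_id, hB.ghost_id, hB.idem, sub_self] at this

/-- The criterion does not mention `r`, which is why the ideal is basic. -/
lemma smul_p_mem_hereditaryIdeal (hsrc : Λ.NoSources) {H : Set V} (hH : IsHereditary H) {r : R}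
    (hr : r ≠ 0) {a : V} :
    r • Λ.p R a ∈ hereditaryIdeal R hsrc hH ↔ ∀ x : Λ.InfPath, x.Avoids H → x.range ≠ a := by
  rw [mem_hereditaryIdeal_of_mem_component hsrc hH
    (Submodule.smul_mem _ r (p_mem_component hsrc a)), NonUnitalSubalgebra.coe_smul, map_smul,
    infPathRep_p]
  constructor
  · rintro h x hx rfl
    exact smul_vertexOp_ne_zero x hx hr h
  · intro h
    rw [vertexOp_eq_zero R h, smul_zero]

lemma p_mem_hereditaryIdeal [Nontrivial R] (hsrc : Λ.NoSources) {H : Set V} (hH : IsHereditary H)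
    {a : V} :
    Λ.p R a ∈ hereditaryIdeal R hsrc hH ↔ ∀ x : Λ.InfPath, x.Avoids H → x.range ≠ a := by
  simpa using smul_p_mem_hereditaryIdeal hsrc hH (one_ne_zero (α := R)) (a := a)

lemma isBasicIdeal_hereditaryIdeal [Nontrivial R] (hsrc : Λ.NoSources) {H : Set V}
    (hH : IsHereditary H) : Λ.IsBasicIdeal (hereditaryIdeal R hsrc hH) := by
  intro r a hr h
  rw [smul_p_mem_hereditaryIdeal hsrc hH hr] at h
  exact (p_mem_hereditaryIdeal hsrc hH).2 h

lemma hereditaryIdeal_ne_bot [Nontrivial R] (hrow : Λ.RowFinite) (hsrc : Λ.NoSources) {H : Set V}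
    (hH : IsHereditary H) {a : V} (ha : a ∈ H) : hereditaryIdeal R hsrc hH ≠ ⊥ := by
  intro h
  have : Λ.p R a ∈ hereditaryIdeal R hsrc hH :=
    (p_mem_hereditaryIdeal hsrc hH).2 fun x hx hxa => hx.range_notMem (hxa ▸ ha)
  rw [h, TwoSidedIdeal.mem_bot] at this
  exact p_ne_zero hrow hsrc a this

/-- Contrapositive of König's lemma: the vertices of the ideal lie in the saturation of `H`. -/
lemma exists_degree_of_p_mem_hereditaryIdeal [Nontrivial R] (hrow : Λ.RowFinite)
    (hsrc : Λ.NoSources) {H : Set V} (hH : IsHereditary H) {a : V}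
    (ha : Λ.p R a ∈ hereditaryIdeal R hsrc hH) :
    ∃ n, ∀ x : Quiver.Total V, x.right = a → Λ.deg x = n → x.left ∈ H := by
  by_contra! h
  obtain ⟨x, hxa, hxH⟩ := Λ.exists_infPath_avoids hrow hH a h
  exact (p_mem_hereditaryIdeal hsrc hH).1 ha x hxH hxa

/-- The vertices that are the source of a path with range `a`. -/
def reachable (a : V) : Set V := {b | Nonempty (b ⟶ a)}

lemma isHereditary_reachable (a : V) : IsHereditary (reachable a) :=
  fun x ⟨f⟩ => ⟨x.hom ≫ f⟩

variable (R) in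
lemma mt3_of_vertexSet_inter [Nontrivial R] (hrow : Λ.RowFinite) (hsrc : Λ.NoSources)
    (h : ∀ I J : TwoSidedIdeal (Λ.KP R), I ≠ ⊥ → J ≠ ⊥ →
      Λ.IsBasicIdeal I → Λ.IsGradedIdeal I → Λ.IsBasicIdeal J → Λ.IsGradedIdeal J →
      (Λ.vertexSet I ∩ Λ.vertexSet J).Nonempty) :
    KGraph.MT3 (Set.univ : Set V) := by
  intro a _ b _
  obtain ⟨c, hc₁, hc₂⟩ := h (hereditaryIdeal R hsrc (isHereditary_reachable a))
    (hereditaryIdeal R hsrc (isHereditary_reachable b))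
    (hereditaryIdeal_ne_bot hrow hsrc _ (a := a) ⟨𝟙 a⟩)
    (hereditaryIdeal_ne_bot hrow hsrc _ (a := b) ⟨𝟙 b⟩)
    (isBasicIdeal_hereditaryIdeal hsrc _) (isGradedIdeal_hereditaryIdeal hrow hsrc _)
    (isBasicIdeal_hereditaryIdeal hsrc _) (isGradedIdeal_hereditaryIdeal hrow hsrc _)
  obtain ⟨m, hm⟩ := exists_degree_of_p_mem_hereditaryIdeal hrow hsrc _ hc₁
  obtain ⟨n, hn⟩ := exists_degree_of_p_mem_hereditaryIdeal hrow hsrc _ hc₂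
  -- A path of degree `m + n` has initial segments of degrees `m` and `n`, ending where `a` and `b`
  -- respectively reach; its source `e` lies beyond both.
  obtain ⟨e, f, hf⟩ := hsrc c (m + n)
  have key : ∀ (l : Fin k → ℕ) (v : V), l ≤ m + n →
      (∀ x : Quiver.Total V, x.right = c → Λ.deg x = l → x.left ∈ reachable v) →
      e ∈ reachable v := by
    intro l v hl hv
    have hle : l ≤ Λ.deg (⟨e, c, f⟩ : Quiver.Total V) := hl.trans_eq hf.symm
    have h₁ := hv _ (pre_right hle) (deg_pre hle)
    rw [← suf_right hle] at h₁
    have h₂ := isHereditary_reachable v _ h₁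
    rwa [suf_left hle] at h₂
  exact ⟨e, trivial, key m a le_self_add hm, key n b le_add_self hn⟩

/-! ### Nonzero basic graded ideals contain vertices -/

lemma exists_mem_component_ne_zero {I : TwoSidedIdeal (Λ.KP R)} (hI : I ≠ ⊥)
    (hgr : Λ.IsGradedIdeal I) : ∃ n, ∃ z ∈ Λ.component R n, z ∈ I ∧ z ≠ 0 := by
  by_contra! h
  refine hI (le_bot_iff.1 fun z hz => ?_)
  rw [TwoSidedIdeal.mem_bot]
  have hle : AddSubgroup.closure {y : Λ.KP R | y ∈ I ∧ ∃ n, y ∈ Λ.component R n} ≤ ⊥ := by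
    rw [AddSubgroup.closure_le]
    rintro y ⟨hy, n, hyn⟩
    exact h n y hyn hy
  exact AddSubgroup.mem_bot.1 (hle (hgr z hz))

lemma exists_p_mem (hrow : Λ.RowFinite) (hsrc : Λ.NoSources) {I : TwoSidedIdeal (Λ.KP R)}
    (hI : I ≠ ⊥) (hb : Λ.IsBasicIdeal I) (hgr : Λ.IsGradedIdeal I) : ∃ a, Λ.p R a ∈ I := by
  obtain ⟨n, z, hzn, hzI, hz₀⟩ := exists_mem_component_ne_zero hI hgr
  obtain ⟨x, y, r, -, -, hr, h⟩ := exists_sStar_mul_mul_s_eq_smul hrow hsrc hzn hz₀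
  refine ⟨x.left, hb r _ hr ?_⟩
  rw [← h]
  exact I.mul_mem_right _ _ (I.mul_mem_left _ _ hzI)

/-- Because `p_{s(x)} = s_{x*} p_{r(x)} s_x`. -/
lemma p_left_mem (hsrc : Λ.NoSources) {I : TwoSidedIdeal (Λ.KP R)} (x : Quiver.Total V)
    (h : Λ.p R x.right ∈ I) : Λ.p R x.left ∈ I := by
  have hB := isKPFamily_gen (Λ := Λ) R hsrc
  rw [← hB.ghost_mul_path_self, ← hB.ghost_mul_vertex]
  exact I.mul_mem_right _ _ (I.mul_mem_left _ _ h)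

lemma vertexSet_inter_of_mt3 (hrow : Λ.RowFinite) (hsrc : Λ.NoSources)
    (hM : KGraph.MT3 (Set.univ : Set V)) {I J : TwoSidedIdeal (Λ.KP R)} (hI : I ≠ ⊥) (hJ : J ≠ ⊥)
    (hIb : Λ.IsBasicIdeal I) (hIg : Λ.IsGradedIdeal I) (hJb : Λ.IsBasicIdeal J)
    (hJg : Λ.IsGradedIdeal J) : (Λ.vertexSet I ∩ Λ.vertexSet J).Nonempty := by
  obtain ⟨a, ha⟩ := exists_p_mem hrow hsrc hI hIb hIg
  obtain ⟨b, hb⟩ := exists_p_mem hrow hsrc hJ hJb hJg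
  obtain ⟨c, -, ⟨f⟩, ⟨g⟩⟩ := hM a trivial b trivial
  exact ⟨c, p_left_mem hsrc ⟨c, a, f⟩ ha, p_left_mem hsrc ⟨c, b, g⟩ hb⟩

end Ideals

/-! ### Primeness -/

section Prime

/-- Elementwise primeness. `J` is the right annihilator of `aA` and `I` the left annihilator of `J`,
so `IJ = 0`. Without a unit, `e` is what places `a` itself in `I`: `ay = aey = 0` for `y ∈ J`. -/
lemma _root_.IsPrimeRing.eq_zero_or_eq_zero {A : Type u} [NonUnitalRing A] (h : IsPrimeRing A)
    {a b e : A} (ha : a * e = a) (hab : ∀ z, a * z * b = 0) : a = 0 ∨ b = 0 := by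
  let J : TwoSidedIdeal A := TwoSidedIdeal.mk' {y | ∀ z, a * z * y = 0} (by simp)
    (fun {x y} hx hy z => by rw [mul_add, hx, hy, add_zero])
    (fun {x} hx z => by rw [mul_neg, hx, neg_zero])
    (fun {x y} hy z => by rw [← mul_assoc, mul_assoc a, hy])
    (fun {x y} hx z => by rw [← mul_assoc, hx, zero_mul])
  have hJ : ∀ {y}, y ∈ J ↔ ∀ z, a * z * y = 0 := TwoSidedIdeal.mem_mk' _ _ _ _ _ _ _
  let I : TwoSidedIdeal A := TwoSidedIdeal.mk' {x | ∀ y ∈ J, x * y = 0} (by simp)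
    (fun {x y} hx hy z hz => by rw [add_mul, hx z hz, hy z hz, add_zero])
    (fun {x} hx z hz => by rw [neg_mul, hx z hz, neg_zero])
    (fun {x y} hy z hz => by rw [mul_assoc, hy z hz, mul_zero])
    (fun {x y} hx z hz => by rw [mul_assoc, hx _ (J.mul_mem_left _ _ hz)])
  have hI : ∀ {x}, x ∈ I ↔ ∀ y ∈ J, x * y = 0 := TwoSidedIdeal.mem_mk' _ _ _ _ _ _ _
  have haI : a ∈ I := hI.2 fun y hy => by rw [← ha, hJ.1 hy]
  have hbJ : b ∈ J := hJ.2 hab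
  rcases h I J fun x hx y hy => (TwoSidedIdeal.mem_bot _).2 (hI.1 hx y hy) with h' | h'
  · exact Or.inl ((TwoSidedIdeal.mem_bot _).1 (h' haI))
  · exact Or.inr ((TwoSidedIdeal.mem_bot _).1 (h' hbJ))

variable {Λ} {R : Type w} [CommRing R]

lemma isDomain_of_isPrimeRing [Nonempty V] [Nontrivial R] (hrow : Λ.RowFinite)
    (hsrc : Λ.NoSources) (h : IsPrimeRing (Λ.KP R)) : IsDomain R := by
  have hB := isKPFamily_gen (Λ := Λ) R hsrc
  obtain ⟨a⟩ := ‹Nonempty V›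
  have : NoZeroDivisors R := ⟨fun {r t} hrt => by
    by_contra! hne
    have h₁ : r • Λ.p R a * Λ.p R a = r • Λ.p R a := by rw [smul_mul_assoc, hB.idem]
    rcases h.eq_zero_or_eq_zero (b := t • Λ.p R a) h₁ fun z => by
      rw [mul_smul_comm, smul_mul_assoc, smul_mul_assoc, smul_smul, mul_comm t, hrt, zero_smul]
      with h' | h'
    · exact smul_p_ne_zero hrow hsrc a hne.1 h'
    · exact smul_p_ne_zero hrow hsrc a hne.2 h'⟩
  exact NoZeroDivisors.to_isDomain R

/-- A spanning element that survives between `p_a` and `p_b` is `s_x s_{y*}` with a common source,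
which is a vertex reachable from both. -/
lemma mt3_of_isPrimeRing [Nontrivial R] (hrow : Λ.RowFinite) (hsrc : Λ.NoSources)
    (h : IsPrimeRing (Λ.KP R)) : KGraph.MT3 (Set.univ : Set V) := by
  have hB := isKPFamily_gen (Λ := Λ) R hsrc
  intro a _ b _
  by_contra! hab
  have key : ∀ z, Λ.p R a * z * Λ.p R b = 0 := by
    intro z
    induction span_path_mul_ghost hrow hsrc z using Submodule.span_induction with
    | zero => rw [mul_zero, zero_mul]
    | add x y _ _ hx hy => rw [mul_add, add_mul, hx, hy, add_zero]
    | smul r x _ hx => rw [mul_smul_comm, smul_mul_assoc, hx, smul_zero]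
    | mem z hz =>
      obtain ⟨⟨⟨c, a', f⟩, ⟨c', b', g⟩⟩, rfl⟩ := hz
      simp only
      by_cases ha : a = a'
      · by_cases hb : b' = b
        · by_cases hc : c = c'
          · subst ha hb hc
            exact absurd ⟨g⟩ (not_nonempty_iff.2 (hab c trivial ⟨f⟩))
          · rw [hB.path_mul_ghost_ne hc, mul_zero, zero_mul]
        · rw [mul_assoc, mul_assoc, hB.ghost_mul_vertex_ne hb, mul_zero, mul_zero]
      · rw [← mul_assoc, hB.vertex_mul_path_ne ha, zero_mul, zero_mul]
  rcases h.eq_zero_or_eq_zero (hB.idem a) key with h' | h'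
  · exact p_ne_zero hrow hsrc a h'
  · exact p_ne_zero hrow hsrc b h'

/-! ### From (MT3) to primeness by unique sums of degrees -/

lemma coaction_injective (hrow : Λ.RowFinite) (hsrc : Λ.NoSources) {z : Λ.KP R}
    (h : coaction hsrc (z : Λ.UnitalKP R) = 0) : z = 0 := by
  obtain ⟨f, -, hf', hf''⟩ := exists_coaction_eq_sum hrow hsrc z
  have : f = 0 := Finsupp.ext fun n => Subtype.ext <| by rw [← hf'', h]; rfl
  rw [← hf', this, Finsupp.sum_zero_index]

lemma coeff_single_mul_mul_single {B G : Type*} [Ring B] [AddCommGroup G]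
    (f : AddMonoidAlgebra B G) (g h : G) (a b : B) (m : G) :
    (.single g a * f * .single h b : AddMonoidAlgebra B G).coeff m =
      a * f.coeff (m - g - h) * b := by
  obtain ⟨m, rfl⟩ : ∃ m', m = g + m' + h := ⟨m - g - h, by abel⟩
  rw [AddMonoidAlgebra.coeff_mul_single_add, AddMonoidAlgebra.coeff_single_mul_add]
  congr 3
  abel

/-- A nonzero coefficient of the coaction is compressed to a multiple of `p a` in degree `0`, for
each vertex `a` which is the source of a path to a certain vertex. -/
lemma exists_compression (hrow : Λ.RowFinite) (hsrc : Λ.NoSources) {z : Λ.KP R} {n : Fin k → ℤ}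
    (hn : (coaction hsrc (z : Λ.UnitalKP R)).coeff n ≠ 0) :
    ∃ (b : V) (r : R), r ≠ 0 ∧ ∀ a, Nonempty (a ⟶ b) → ∃ s t : Λ.KP R,
      (coaction hsrc ((s * z * t : Λ.KP R) : Λ.UnitalKP R)).coeff 0 =
        ((r • Λ.p R a : Λ.KP R) : Λ.UnitalKP R) ∧
      ∀ m, (coaction hsrc ((s * z * t : Λ.KP R) : Λ.UnitalKP R)).coeff m ≠ 0 →
        (coaction hsrc (z : Λ.UnitalKP R)).coeff (m + n) ≠ 0 := by
  have hB := isKPFamily_gen (Λ := Λ) R hsrc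
  obtain ⟨f, hf, -, hf''⟩ := exists_coaction_eq_sum hrow hsrc z
  have hfn : f n ≠ 0 := fun h => hn (by rw [hf'', h]; rfl)
  obtain ⟨x, y, r, hxy, hd, hr, h⟩ := exists_sStar_mul_mul_s_eq_smul hrow hsrc (hf n) hfn
  refine ⟨x.left, r, hr, fun a ⟨l⟩ => ?_⟩
  -- Prolonging `x` and `y` by the same `q` keeps the degree difference `n` and moves the resulting
  -- idempotent from `s(x)` to `a`.
  let q : Quiver.Total V := ⟨a, x.left, l⟩
  have hcoeff : ∀ m, (coaction hsrc ((Λ.sStar R (comp x q rfl) * z * Λ.s R (comp y q hxy.symm) :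
      Λ.KP R) : Λ.UnitalKP R)).coeff m =
      ((Λ.sStar R (comp x q rfl) * f (m + n) * Λ.s R (comp y q hxy.symm) : Λ.KP R) :
        Λ.UnitalKP R) := by
    intro m
    rw [NonUnitalSubalgebra.coe_mul, NonUnitalSubalgebra.coe_mul, map_mul, map_mul, coaction_s,
      coaction_sStar, coeff_single_mul_mul_single, NonUnitalSubalgebra.coe_mul,
      NonUnitalSubalgebra.coe_mul, ← hf'', ← hd, intDeg_comp, intDeg_comp]
    congr 4
    abel
  refine ⟨_, _, (hcoeff 0).trans ?_, fun m hm h₀ => hm ?_⟩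
  · rw [zero_add, ← hB.ghost_mul_ghost _ _ rfl, ← hB.path_mul_path _ _ hxy.symm]
    have h₁ : Λ.sStar R q * Λ.sStar R x * f n * (Λ.s R y * Λ.s R q) =
        Λ.sStar R q * (Λ.sStar R x * f n * Λ.s R y) * Λ.s R q := by simp only [mul_assoc]
    have h₂ : Λ.sStar R q * Λ.p R x.left = Λ.sStar R q := hB.ghost_mul_vertex q
    rw [h₁, h, mul_smul_comm, smul_mul_assoc, h₂, hB.ghost_mul_path_self]
  · have : f (m + n) = 0 := Subtype.ext ((hf'' _).symm.trans h₀)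
    rw [hcoeff, this, mul_zero, zero_mul]
    rfl

lemma isPrimeRing_of_mt3 [IsDomain R] (hrow : Λ.RowFinite) (hsrc : Λ.NoSources)
    (hM : KGraph.MT3 (Set.univ : Set V)) : IsPrimeRing (Λ.KP R) := by
  have hB := isKPFamily_gen (Λ := Λ) R hsrc
  have exists_ne : ∀ I : TwoSidedIdeal (Λ.KP R), ¬ I ≤ ⊥ → ∃ z ∈ I,
      (coaction hsrc (z : Λ.UnitalKP R)).coeff.support.Nonempty := by
    intro I hI
    obtain ⟨z, hz, hz'⟩ := SetLike.not_le_iff_exists.1 hI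
    refine ⟨z, hz, Finsupp.support_nonempty_iff.2 fun h => hz' ?_⟩
    exact (TwoSidedIdeal.mem_bot _).2
      (coaction_injective hrow hsrc (AddMonoidAlgebra.coeff_eq_zero.1 h))
  intro I J hIJ
  by_contra! hne
  obtain ⟨x, hxI, hx⟩ := exists_ne I hne.1
  obtain ⟨y, hyJ, hy⟩ := exists_ne J hne.2
  -- No other pair of degrees from the two supports adds up to `m + n`, so the corresponding part of
  -- a product cannot cancel.
  obtain ⟨m, hm, n, hn, hu⟩ := UniqueSums.uniqueAdd_of_nonempty hx hy
  obtain ⟨a, r, hr, ha⟩ := exists_compression hrow hsrc (Finsupp.mem_support_iff.1 hm)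
  obtain ⟨b, t, ht, hb⟩ := exists_compression hrow hsrc (Finsupp.mem_support_iff.1 hn)
  obtain ⟨c, -, hca, hcb⟩ := hM a trivial b trivial
  obtain ⟨s₁, t₁, h₁, h₁'⟩ := ha c hca
  obtain ⟨s₂, t₂, h₂, h₂'⟩ := hb c hcb
  have hxy : s₁ * x * t₁ * (s₂ * y * t₂) = 0 := (TwoSidedIdeal.mem_bot _).1 <|
    hIJ _ (I.mul_mem_right _ _ (I.mul_mem_left _ _ hxI))
      _ (J.mul_mem_right _ _ (J.mul_mem_left _ _ hyJ))
  -- Compression translates the supports by `-m` and `-n`, up to losing points, so uniqueness of `m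
  -- + n` becomes uniqueness of `0 + 0`.
  have huniq : UniqueAdd (coaction hsrc ((s₁ * x * t₁ : Λ.KP R) : Λ.UnitalKP R)).coeff.support
      (coaction hsrc ((s₂ * y * t₂ : Λ.KP R) : Λ.UnitalKP R)).coeff.support 0 0 := by
    intro i j hi hj hij
    have := hu (Finsupp.mem_support_iff.2 (h₁' i (Finsupp.mem_support_iff.1 hi)))
      (Finsupp.mem_support_iff.2 (h₂' j (Finsupp.mem_support_iff.1 hj))) (by
        rw [add_add_add_comm, hij, add_zero, zero_add])
    simpa using this
  have hc := AddMonoidAlgebra.coeff_mul_add_of_uniqueAdd huniq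
  rw [← map_mul, ← NonUnitalSubalgebra.coe_mul, hxy, h₁, h₂, ← NonUnitalSubalgebra.coe_mul,
    smul_mul_smul_comm, hB.idem] at hc
  refine smul_p_ne_zero hrow hsrc c (mul_ne_zero hr ht) (Subtype.ext (hc.symm.trans ?_))
  simp

end Prime

end KGraph

end

theorem theorem3p3 {k : ℕ} (hk : 0 < k) {V : Type u} [Category.{v} V] [Nonempty V]
    (Λ : KGraph k V) (hrow : Λ.RowFinite) (hsrc : Λ.NoSources)
    (R : Type w) [CommRing R] [Nontrivial R] :
    List.TFAE
      [IsPrimeRing (Λ.KP R),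
       IsDomain R ∧ KGraph.MT3 (Set.univ : Set V),
       IsDomain R ∧ ∀ I J : TwoSidedIdeal (Λ.KP R), I ≠ ⊥ → J ≠ ⊥ →
         Λ.IsBasicIdeal I → Λ.IsGradedIdeal I → Λ.IsBasicIdeal J → Λ.IsGradedIdeal J →
         (Λ.vertexSet I ∩ Λ.vertexSet J).Nonempty] := by
  tfae_have 1 → 2 := fun h =>
    ⟨KGraph.isDomain_of_isPrimeRing hrow hsrc h, KGraph.mt3_of_isPrimeRing hrow hsrc h⟩
  tfae_have 2 → 1 := fun ⟨_, hM⟩ => KGraph.isPrimeRing_of_mt3 hrow hsrc hM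
  tfae_have 2 → 3 := fun ⟨hR, hM⟩ => ⟨hR, fun _ _ => KGraph.vertexSet_inter_of_mt3 hrow hsrc hM⟩
  tfae_have 3 → 2 := fun ⟨hR, h⟩ => ⟨hR, KGraph.mt3_of_vertexSet_inter R hrow hsrc h⟩
  tfae_finish
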